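/- Let $m\ge n\ge 2$ with $(m,n)\neq(2,2)$, let $G_{m,n}=\langle x,y\mid x^m=y^n\rangle$, $Z_{m,n}=\mathbb Z_m*\mathbb Z_n=\langle X,Y\mid X^m=Y^n=1\rangle$, and let $\pi:G_{m,n}\to Z_{m,n}$ be given by $\pi(x)=X$, $\pi(y)=Y$. Put $\mathcal S=(s_1,s_2)$ with $s_1=xyx^{-m+1}$, $s_2=x^{m-1}y^{-1}$. An element of $G_{m,n}$ is $\sigma$-positive if it is represented by a word in $s_1^{\pm1},s_2^{\pm1}$ which either contains $s_1$ but not $s_1^{-1}$, or contains $s_2$ but none of $s_1,s_1^{-1},s_2^{-1}$. Write $g<_D h$ if $g^{-1}h$ is $\sigma$-positive. Let $T$ be the Bass–Serre tree of $Z_{m,n}$: its vertices are the cosets $gP=g\langle X\rangle$ and $gQ=g\langle Y\rangle$, and each $g\in Z_{m,n}$ is an edge joining $gP$ and $gQ$. Regard $T$ as a planar tree in which the edges at $gP$ are $g,gX,\dots,gX^{m-1}$ and the edges at $gQ$ are $g,gY,\dots,gY^{n-1}$, in positive cyclic order. This gives a cyclic order on the set $E(T)$ of ends, on which $Z_{m,n}$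 acts. An end is coded by $\pm l_1l_2\cdots$, where the ray from the midpoint of the edge $PQ$ passes first through $P$ (sign $+$) or $Q$ (sign $-$), and $l_k\ge1$ is the position, in positive cyclic order counted from the edge just traversed, of the edge along which the ray leaves its $k$-th vertex. A standard action consists of an embedding of $E(T)$ onto a closed subset of $S^1=\mathbb R/\mathbb Z$ respecting the cyclic orders, an action of $Z_{m,n}$ on $S^1$ by orientation-preserving homeomorphisms extending its action on $E(T)$, and a lift $\Theta:G_{m,n}\to\mathrm{Homeo}_+(\mathbb R)$ of this action (along $\pi$ and $\mathbb R\to\mathbb R/\mathbb Z$) for which $x^m=y^n$ acts as $t\mapsto t+1$. Fix a lift $O\in\mathbb R$ of the end $-111\cdots$; for $N\in\mathbb Z$ let $(N;\pm l_1l_2\cdots)\in\mathbb R$ be the lift of the end $\pm l_1l_2\cdots$ lying in $[O+N,O+N+1)$. Put $E=(0;-111\cdots)$ and $F=(0;+111\cdots)$, and write $g<_{\{E,F\}}h$ if $\Theta(g)E<\Theta(h)E$, or $\Theta(g)E=\Theta(h)E$ and $\Theta(g)F<\Theta(h)F$. Then standard actions exist; $\mathcal S$ generates $G_{m,n}$ and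 $<_D$ is a left ordering of $G_{m,n}$ (the Dehornoy-like ordering defined by $\mathcal S$); and for every standard action and every choice of $O$, the relation $<_{\{E,F\}}$ is a left ordering of $G_{m,n}$ and coincides with $<_D$. -/

import Mathlib

namespace DehornoyLike

/-! ### Left orderings and Dehornoy-like orderings -/

section Orderings

variable {G : Type*} [Group G]

/-- A left ordering of a group: a strict total order invariant under left multiplication. -/
structure IsLeftOrdering (lt : G → G → Prop) : Prop where
  irrefl : ∀ g, ¬ lt g g
  trans : ∀ g h k, lt g h → lt h k → lt g k
  total : ∀ g h, lt g h ∨ g = h ∨ lt h g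
  mul_left : ∀ h g g', lt g g' → lt (h * g) (h * g')

/-- The element represented by a word on `S ∪ S⁻¹`; the letter `(i, true)` stands for `S i` and
`(i, false)` for `(S i)⁻¹`. -/
def wordEval {k : ℕ} (S : Fin k → G) (w : List (Fin k × Bool)) : G :=
  (w.map fun p => if p.2 then S p.1 else (S p.1)⁻¹).prod

/-- A word is `i`-positive if it contains the letter `s_i` but none of
`s_j^{±1}` (`j < i`) and `s_i⁻¹`. -/
def IsPositiveWord {k : ℕ} (i : Fin k) (w : List (Fin k × Bool)) : Prop :=
  (i, true) ∈ w ∧ ∀ p ∈ w, i ≤ p.1 ∧ p ≠ (i, false)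

/-- The set of `σ(S)`-positive elements. -/
def sigmaPositive {k : ℕ} (S : Fin k → G) : Set G :=
  {g | ∃ i w, IsPositiveWord i w ∧ wordEval S w = g}

/-- The relation `h <_D g` given by `h⁻¹ g` being `σ(S)`-positive. -/
def dehornoyLT {k : ℕ} (S : Fin k → G) (h g : G) : Prop :=
  h⁻¹ * g ∈ sigmaPositive S

/-- `lt` is the Dehornoy-like ordering defined by the ordered finite generating set `S`. -/
structure IsDehornoyLike {k : ℕ} (S : Fin k → G) (lt : G → G → Prop) : Prop where
  generates : Subgroup.closure (Set.range S) = ⊤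
  isLeftOrdering : IsLeftOrdering lt
  positiveCone : {g | lt 1 g} = sigmaPositive S

/-- The relation on `G` defined by an action `Θ` on the real line and a finite sequence `x` of
points: compare the images of the first point of the sequence at which `g` and `g'` differ.
The group `ℝ ≃o ℝ` is the group of orientation-preserving homeomorphisms of the line. -/
def ltOfPoints (Θ : G →* (ℝ ≃o ℝ)) {k : ℕ} (x : Fin k → ℝ) (g g' : G) : Prop :=
  ∃ j, (∀ i < j, Θ g (x i) = Θ g' (x i)) ∧ Θ g (x j) < Θ g' (x j)

end Orderings

/-! ### The groups `G_{m,n}` and `ℤ_m * ℤ_n` -/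

/-- `G_{m,n} = ⟨x, y ∣ x ^ m = y ^ n⟩`. -/
abbrev Gmn (m n : ℕ) : Type :=
  PresentedGroup ({FreeGroup.of 0 ^ m * (FreeGroup.of 1 ^ n)⁻¹} : Set (FreeGroup (Fin 2)))

/-- The generator `x` of `G_{m,n}`. -/
def x (m n : ℕ) : Gmn m n := PresentedGroup.of 0

/-- The generator `y` of `G_{m,n}`. -/
def y (m n : ℕ) : Gmn m n := PresentedGroup.of 1

/-- The ordered generating set `s₁ = x y x^{-m+1}`, `s₂ = x^{m-1} y⁻¹`. -/
def S (m n : ℕ) : Fin 2 → Gmn m n :=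
  ![x m n * y m n * x m n ^ (-(m : ℤ) + 1), x m n ^ ((m : ℤ) - 1) * (y m n)⁻¹]

/-- `Z_{m,n} = ℤ_m * ℤ_n`. -/
abbrev Zmn (m n : ℕ) : Type :=
  Monoid.Coprod (Multiplicative (ZMod m)) (Multiplicative (ZMod n))

/-- The generator `X` of `ℤ_m`. -/
def X (m n : ℕ) : Zmn m n := Monoid.Coprod.inl (Multiplicative.ofAdd 1)

/-- The generator `Y` of `ℤ_n`. -/
def Y (m n : ℕ) : Zmn m n := Monoid.Coprod.inr (Multiplicative.ofAdd 1)

theorem X_pow (m n : ℕ) : X m n ^ m = 1 := by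
  rw [X, ← map_pow, ← ofAdd_nsmul]; simp

theorem Y_pow (m n : ℕ) : Y m n ^ n = 1 := by
  rw [Y, ← map_pow, ← ofAdd_nsmul]; simp

/-- The projection `π : G_{m,n} → Z_{m,n}` with `π x = X` and `π y = Y`. -/
def proj (m n : ℕ) : Gmn m n →* Zmn m n :=
  PresentedGroup.toGroup (f := ![X m n, Y m n]) (by simp [X_pow, Y_pow])

/-! ### The Bass-Serre tree and its ends -/

/-- The vertices of the Bass-Serre tree: cosets of `ℤ_m` and cosets of `ℤ_n`. -/
abbrev Vertex (m n : ℕ) : Type :=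
  (Zmn m n ⧸ Subgroup.zpowers (X m n)) ⊕ (Zmn m n ⧸ Subgroup.zpowers (Y m n))

/-- The letter `X` for `true`, the letter `Y` for `false`. -/
def letter (m n : ℕ) (b : Bool) : Zmn m n := if b then X m n else Y m n

/-- The order of a letter, which is the valence of the vertices of the corresponding type. -/
def valence (m n : ℕ) (b : Bool) : ℕ := if b then m else n

/-- The end point of the edge `g` of the given type: the coset `g ℤ_m` (the vertex `g P`) for
`true`, the coset `g ℤ_n` (the vertex `g Q`) for `false`. -/
def vert {m n : ℕ} (b : Bool) (g : Zmn m n) : Vertex m n :=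
  if b then Sum.inl (QuotientGroup.mk g) else Sum.inr (QuotientGroup.mk g)

/-- The Bass-Serre tree: the edge `g ∈ Z_{m,n}` joins `g ℤ_m` and `g ℤ_n`. -/
def tree (m n : ℕ) : SimpleGraph (Vertex m n) where
  Adj u v := ∃ (g : Zmn m n) (b : Bool), u = vert b g ∧ v = vert (!b) g
  symm := ⟨by
    rintro u v ⟨g, b, rfl, rfl⟩
    exact ⟨g, !b, rfl, by simp⟩⟩
  loopless := ⟨by
    rintro u ⟨g, b, rfl, h⟩
    cases b <;> simp [vert] at h⟩

/-- A ray: an infinite path without backtracking. -/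
structure Ray (m n : ℕ) where
  toFun : ℕ → Vertex m n
  adj : ∀ k, (tree m n).Adj (toFun k) (toFun (k + 1))
  reduced : ∀ k, toFun (k + 2) ≠ toFun k

/-- Two rays define the same end if they have a common tail. -/
def raySetoid (m n : ℕ) : Setoid (Ray m n) where
  r r s := ∃ a b, ∀ k, r.toFun (a + k) = s.toFun (b + k)
  iseqv :=
    { refl := fun _ => ⟨0, 0, fun _ => rfl⟩
      symm := fun ⟨a, b, h⟩ => ⟨b, a, fun k => (h k).symm⟩
      trans := by
        rintro r s t ⟨a, b, h⟩ ⟨c, d, h'⟩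
        refine ⟨a + c, d + b, fun k => ?_⟩
        have h1 := h (c + k)
        have h2 := h' (b + k)
        rw [show a + c + k = a + (c + k) by ring, h1, show d + b + k = d + (b + k) by ring, ← h2]
        congr 1
        ring }

/-- The set `E(T)` of ends of the tree. -/
def Ends (m n : ℕ) : Type := Quotient (raySetoid m n)

/-- The end of a ray. -/
def Ray.toEnd {m n : ℕ} (r : Ray m n) : Ends m n := Quotient.mk _ r

theorem smul_vert {m n : ℕ} (g h : Zmn m n) (b : Bool) : g • vert b h = vert b (g * h) := by
  cases b <;> rfl

/-- The translate of a ray by an element of `Z_{m,n}`. -/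
def Ray.smul {m n : ℕ} (g : Zmn m n) (r : Ray m n) : Ray m n where
  toFun k := g • r.toFun k
  adj k := by
    obtain ⟨h, b, h1, h2⟩ := r.adj k
    exact ⟨g * h, b, by rw [h1, smul_vert], by rw [h2, smul_vert]⟩
  reduced k h := r.reduced k (MulAction.injective g h)

/-- The action of `Z_{m,n}` on the ends of the tree. -/
def Ends.smul {m n : ℕ} (g : Zmn m n) : Ends m n → Ends m n :=
  Quotient.map (Ray.smul g) (by
    rintro r s ⟨a, b, h⟩
    exact ⟨a, b, fun k => congrArg (g • ·) (h k)⟩)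

/-- The cyclic order on the ends of the planar tree. The tree is embedded in the oriented plane so
that the edges around the vertex `g P` are `g, g X, g X², …, g X^{m-1}` and those around `g Q` are
`g, g Y, …, g Y^{n-1}`, in the positive cyclic order. Three distinct ends are joined by
a tripod, and are ordered as the three edges that leave the centre of the tripod. -/
def Ends.Cyc {m n : ℕ} (e₁ e₂ e₃ : Ends m n) : Prop :=
  ∃ (b : Bool) (g : Zmn m n) (j k : ℕ) (r₁ r₂ r₃ : Ray m n),
    0 < j ∧ j < k ∧ k < valence m n b ∧
    r₁.toEnd = e₁ ∧ r₂.toEnd = e₂ ∧ r₃.toEnd = e₃ ∧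
    r₁.toFun 0 = vert b g ∧ r₁.toFun 1 = vert (!b) g ∧
    r₂.toFun 0 = vert b g ∧ r₂.toFun 1 = vert (!b) (g * letter m n b ^ j) ∧
    r₃.toFun 0 = vert b g ∧ r₃.toFun 1 = vert (!b) (g * letter m n b ^ k)

/-! ### The coding of ends by sequences of labels -/

/-- A sequence `± l₁ l₂ l₃ …` of edge labels. The sign `+` (`true`) means that the ray from the
midpoint of the edge `PQ` passes first through `P`, the sign `-` that it passes first through `Q`;
at each vertex, the edges other than the one just traversed are labelled `1, 2, …` in the positive
cyclic order. The label `l_{k+1}` is `label k`. -/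
structure Code (m n : ℕ) where
  sign : Bool
  label : ℕ → ℕ
  pos : ∀ k, 0 < label k
  lt : ∀ k, label k < valence m n (xor sign k.bodd)

namespace Code

variable {m n : ℕ} (c : Code m n)

/-- The type of the vertex at which the label `label k` is read. -/
def side (k : ℕ) : Bool := xor c.sign k.bodd

/-- The edges traversed by the ray: `edge 0 = 1` is the edge `PQ`, and
`edge (k + 1) = edge k * X ^ label k` or `edge k * Y ^ label k` in turn. -/
def edge : ℕ → Zmn m n
  | 0 => 1
  | k + 1 => edge k * letter m n (c.side k) ^ c.label k

theorem side_succ (k : ℕ) : c.side (k + 1) = !c.side k := by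
  simp [side, Nat.bodd_succ]

theorem vert_mul_pow (b : Bool) (g : Zmn m n) (l : ℕ) :
    vert b (g * letter m n b ^ l) = vert b g := by
  cases b
  · exact congrArg Sum.inr (QuotientGroup.eq.2 (by
      rw [mul_inv_rev, mul_assoc, inv_mul_cancel, mul_one]
      exact inv_mem (pow_mem (Subgroup.mem_zpowers _) l)))
  · exact congrArg Sum.inl (QuotientGroup.eq.2 (by
      rw [mul_inv_rev, mul_assoc, inv_mul_cancel, mul_one]
      exact inv_mem (pow_mem (Subgroup.mem_zpowers _) l)))

theorem vert_ne (b : Bool) (g : Zmn m n) {l : ℕ} (h0 : 0 < l) (h : l < valence m n b) :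
    vert (!b) (g * letter m n b ^ l) ≠ vert (!b) g := by
  intro he
  cases b
  · have h1 := QuotientGroup.eq.1 (Sum.inl_injective he)
    rw [mul_inv_rev, mul_assoc, inv_mul_cancel, mul_one] at h1
    obtain ⟨z, hz⟩ := h1
    have h2 := congrArg (Monoid.Coprod.snd (M := Multiplicative (ZMod m))) hz
    simp only [letter, X, Y, map_zpow, map_inv, map_pow, Monoid.Coprod.snd_apply_inl,
      Monoid.Coprod.snd_apply_inr, one_zpow, Bool.false_eq_true, if_false] at h2
    have h3 := inv_eq_one.1 h2.symm
    rw [← ofAdd_nsmul, ofAdd_eq_one, nsmul_one, ZMod.natCast_eq_zero_iff] at h3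
    exact absurd (Nat.le_of_dvd h0 h3) (not_le.2 h)
  · have h1 := QuotientGroup.eq.1 (Sum.inr_injective he)
    rw [mul_inv_rev, mul_assoc, inv_mul_cancel, mul_one] at h1
    obtain ⟨z, hz⟩ := h1
    have h2 := congrArg (Monoid.Coprod.fst (N := Multiplicative (ZMod n))) hz
    simp only [letter, X, Y, map_zpow, map_inv, map_pow, Monoid.Coprod.fst_apply_inl,
      Monoid.Coprod.fst_apply_inr, one_zpow, if_true] at h2
    have h3 := inv_eq_one.1 h2.symm
    rw [← ofAdd_nsmul, ofAdd_eq_one, nsmul_one, ZMod.natCast_eq_zero_iff] at h3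
    exact absurd (Nat.le_of_dvd h0 h3) (not_le.2 h)

/-- The ray with the given labels, extended backwards from the midpoint of `PQ` to a vertex; its
`k`-th step is the edge `edge k`. -/
def ray : Ray m n where
  toFun k := vert (!c.side k) (c.edge k)
  adj k := ⟨c.edge k, !c.side k, rfl, by
    rw [side_succ, Bool.not_not]
    exact vert_mul_pow _ _ _⟩
  reduced k := by
    have h1 : vert (!c.side (k + 2)) (c.edge (k + 2)) = vert (!c.side k) (c.edge (k + 1)) := by
      have h2 : (!c.side (k + 2)) = c.side (k + 1) := by rw [c.side_succ (k + 1), Bool.not_not]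
      rw [h2, c.side_succ k, ← c.side_succ k]
      exact vert_mul_pow _ _ _
    rw [h1]
    exact vert_ne _ _ (c.pos k) (c.lt k)

/-- The end with the given labels. -/
def toEnd : Ends m n := c.ray.toEnd

/-- The sequence `± 1 1 1 …`. -/
def ones (hm : 2 ≤ m) (hn : 2 ≤ n) (s : Bool) : Code m n where
  sign := s
  label _ := 1
  pos _ := one_pos
  lt k := by
    cases xor s k.bodd
    · exact hn
    · exact hm

end Code

/-! ### The standard action -/

/-- A standard action of `G_{m,n}` on the real line. It consists of
* an embedding `ι` of the set of ends of the planar tree into the circle `ℝ / ℤ` that respects the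
  cyclic orders and has closed image (equivalently, which is a topological embedding of the Cantor
  set of ends, compatible with the planar structure);
* an action `ρ` of `Z_{m,n}` on the circle by orientation-preserving homeomorphisms that extends
  the action on the ends;
* the lift `Θ` of `ρ` to an action of `G_{m,n}` on the universal cover `ℝ`, for which the central
  element `x ^ m = y ^ n` acts as the positive generator `t ↦ t + 1` of the deck group. -/
structure StandardAction (m n : ℕ) where
  ι : Ends m n → AddCircle (1 : ℝ)
  injective : Function.Injective ι
  sbtw_of_cyc : ∀ e₁ e₂ e₃, Ends.Cyc e₁ e₂ e₃ → sbtw (ι e₁) (ι e₂) (ι e₃)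
  isClosed_range : IsClosed (Set.range ι)
  ρ : Zmn m n →* (AddCircle (1 : ℝ) ≃ₜ AddCircle (1 : ℝ))
  sbtw_map : ∀ g a b c, sbtw a b c → sbtw (ρ g a) (ρ g b) (ρ g c)
  extends_ends : ∀ g e, ρ g (ι e) = ι (Ends.smul g e)
  Θ : Gmn m n →* (ℝ ≃o ℝ)
  lift : ∀ (g : Gmn m n) (t : ℝ),
    ((Θ g t : ℝ) : AddCircle (1 : ℝ)) = ρ (proj m n g) (t : AddCircle (1 : ℝ))
  central : ∀ t : ℝ, Θ (x m n ^ m) t = t + 1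

/-- The point `(N; ± l₁ l₂ …)` of the preimage of the set of ends in `ℝ`: the lift of the end
`± l₁ l₂ …` in the fundamental domain `[O + N, O + N + 1)`. The origin `O` is to be a lift of the
end `- 1 1 1 …`, so that `O = (0; - 1 1 1 …)`. -/
noncomputable def StandardAction.point {m n : ℕ} (A : StandardAction m n) (O : ℝ) (N : ℤ)
    (c : Code m n) : ℝ :=
  AddCircle.equivIco 1 (O + N) (A.ι c.toEnd)

end DehornoyLike

/-! Write `Δ = x^m = y^n`, which is central, `a = s₁` and `b = s₂`; then `x = ab` and `y =
b⁻¹x^{m-1}`, so `a` and `b` generate. Comparison at `(E, F)` is clearly irreflexive, transitive and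
left invariant, but not clearly total. Two facts are enough to identify it with `<_D` and to make it
total: every element is `σ`-positive, trivial or `σ`-negative, and every `σ`-positive element moves
`(E, F)` up lexicographically. This deduction is `ltOfPoints_iff_dehornoyLT`.

The trichotomy is algebraic. It reduces to showing that `g` or `g⁻¹` lies in the monoid `M`
generated by `a`, `b` and `b⁻¹`, since an element of `M` is a power of `b` or has a word that
contains `a` and not `a⁻¹`. Every `g` can be written `Δ^k x^i u b^r`, with `u` a product of
syllables `Δ⁻¹y^j x^i` (`mem_normalForms`); uniqueness is not needed. The syllables are in `M`,
hence so is `g` if `k ≥ 0`. If `k < 0`, one spare factor `Δ` turns `(x^i u)⁻¹` into an element of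
`M`, so `g⁻¹ ∈ M` (`mem_sigmaMonoid_or_inv_mem`).

Positivity is dynamical. On ends, `X` maps `-111…` to `+111…` and `Y` maps it back; on the line this
gives `xE = F` and `yF = E + 1`. Hence `bE = E` and `aE = F > E`, while `bF > F` follows from `m ≥
3` (`points_action`).

A standard action is built by ping-pong: `x` is translation by `1/m`, and `y` is a piecewise linear
conjugate of translation by `1/n`. Nontrivial powers of `x` map `(m/(m+1), 1)` into `(0, m/(m+1))`
modulo `1`, those of `y` map the latter affinely into the former, and a code is sent to the sum of
the series obtained by iterating these affine maps. Besides giving existence, this action is what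
shows that `<_D` is a left ordering. -/

namespace DehornoyLike

/-! ### Every element is `σ`-positive, trivial or `σ`-negative -/

section Trichotomy

variable {G : Type*} [Group G]

/-- The monoid generated by the syllables `x⁻ᵐ yʲ xⁱ` with `0 < i < m` and `0 < j < n`. -/
def syllables (x y : G) (m n : ℕ) : Submonoid G :=
  Submonoid.closure {g | ∃ i j : ℕ, 0 < i ∧ i < m ∧ 0 < j ∧ j < n ∧ g = (x ^ m)⁻¹ * y ^ j * x ^ i}

theorem syllables_cases {x y : G} {m n : ℕ} {u : G} (hu : u ∈ syllables x y m n) :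
    u = 1 ∨ ∃ i j : ℕ, ∃ v ∈ syllables x y m n, 0 < i ∧ i < m ∧ 0 < j ∧ j < n ∧
      u = (x ^ m)⁻¹ * y ^ j * x ^ i * v := by
  induction hu using Submonoid.closure_induction_left with
  | one => exact Or.inl rfl
  | mul_left g hg v hv _ =>
    obtain ⟨i, j, h1, h2, h3, h4, rfl⟩ := hg
    exact Or.inr ⟨i, j, v, hv, h1, h2, h3, h4, rfl⟩

theorem mul_mem_syllables {x y : G} {m n i j : ℕ} {v : G} (hi : 0 < i) (hi' : i < m) (hj : 0 < j)
    (hj' : j < n) (hv : v ∈ syllables x y m n) :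
    (x ^ m)⁻¹ * y ^ j * x ^ i * v ∈ syllables x y m n :=
  mul_mem (Submonoid.subset_closure ⟨i, j, hi, hi', hj, hj', rfl⟩) hv

/-- The elements with a normal form `x^{mk} xⁱ u bʳ`, where `u` is a product of syllables and
`b = x^{m-1} y⁻¹`. -/
def normalForms (x y : G) (m n : ℕ) : Set G :=
  {g | ∃ (k : ℤ) (i : ℕ) (u : G) (r : ℤ), i < m ∧ u ∈ syllables x y m n ∧
    g = (x ^ m) ^ k * x ^ i * u * (x ^ (m - 1) * y⁻¹) ^ r}

variable {x y : G} {m n : ℕ}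

theorem zpow_mul_mem_normalForms (k : ℤ) {g : G} (hg : g ∈ normalForms x y m n) :
    (x ^ m) ^ k * g ∈ normalForms x y m n := by
  obtain ⟨l, i, u, r, hi, hu, rfl⟩ := hg
  exact ⟨k + l, i, u, r, hi, hu, by simp only [zpow_add, mul_assoc]⟩

theorem x_mul_mem_normalForms (hm : 2 ≤ m) {g : G} (hg : g ∈ normalForms x y m n) :
    x * g ∈ normalForms x y m n := by
  obtain ⟨l, i, u, r, hi, hu, rfl⟩ := hg
  have hc : x * (x ^ m) ^ l = (x ^ m) ^ l * x :=
    (((Commute.refl x).pow_right m).zpow_right l)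
  rcases Nat.lt_or_ge (i + 1) m with h | h
  · refine ⟨l, i + 1, u, r, h, hu, ?_⟩
    simp only [← mul_assoc, hc, pow_succ' x i]
  · have h' : m = i + 1 := by omega
    refine ⟨l + 1, 0, u, r, by omega, hu, ?_⟩
    rw [zpow_add_one]
    conv_rhs => rw [show x ^ m = x ^ (i + 1) from by rw [h']]
    simp only [← mul_assoc, pow_zero, mul_one]
    rw [← h', hc, h']
    simp only [pow_succ', mul_assoc]

/-- If `i > 0`, then `y x^i = Δ · (Δ⁻¹ y x^i)` creates a syllable. If `i = 0`, the letter `y` joins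
the first syllable of `u`; should its exponent reach `n`, then `y^n` cancels `Δ⁻¹` and the power of
`x` becomes the new prefix. -/
theorem y_mul_mem_normalForms (hm : 2 ≤ m) (hn : 2 ≤ n) (hxy : x ^ m = y ^ n) {g : G}
    (hg : g ∈ normalForms x y m n) : y * g ∈ normalForms x y m n := by
  obtain ⟨l, i, u, r, hi, hu, rfl⟩ := hg
  have hc : Commute y (x ^ m) := by rw [hxy]; exact (Commute.refl y).pow_right n
  rw [mul_assoc, mul_assoc, ← mul_assoc y, (hc.zpow_right l).eq, mul_assoc]
  apply zpow_mul_mem_normalForms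
  rcases Nat.eq_zero_or_pos i with rfl | hi0
  · have key : ∀ (i j : ℕ) (v : G) (r : ℤ), v ∈ syllables x y m n → 0 < i → i < m → 0 < j → j < n →
        y * ((x ^ m)⁻¹ * y ^ j * x ^ i * v * (x ^ (m - 1) * y⁻¹) ^ r) ∈ normalForms x y m n := by
      intro i j v r hv hi hi' hj hj'
      have e : y * ((x ^ m)⁻¹ * y ^ j * x ^ i * v * (x ^ (m - 1) * y⁻¹) ^ r) =
          (x ^ m)⁻¹ * y ^ (j + 1) * x ^ i * v * (x ^ (m - 1) * y⁻¹) ^ r := by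
        simp only [← mul_assoc, hc.inv_right.eq, pow_succ']
      rw [e]
      rcases Nat.lt_or_ge (j + 1) n with h | h
      · exact ⟨0, 0, _, r, by omega, mul_mem_syllables hi hi' (Nat.succ_pos j) h hv, by simp⟩
      · have h' : j + 1 = n := by omega
        refine ⟨0, i, v, r, hi', hv, ?_⟩
        rw [h', ← hxy]; simp
    rcases syllables_cases hu with rfl | ⟨i, j, v, hv, h1, h2, h3, h4, rfl⟩
    -- There is no syllable to absorb `y`. Since `b⁻¹ = Δ⁻¹ y x` is itself a syllable, `b^r` is
    -- rewritten as that syllable times `b^(r+1)`.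
    · have h := key 1 1 1 (r + 1) (one_mem _) one_pos (by omega) one_pos (by omega)
      convert h using 2
      have e : x ^ m = x * x ^ (m - 1) := by rw [← pow_succ']; congr 1; omega
      have e' : (x ^ m)⁻¹ * y * x = (x ^ (m - 1) * y⁻¹)⁻¹ := by
        rw [← hc.inv_right.eq, e]; group
      rw [pow_one, pow_one, e', mul_one, add_comm, zpow_add, zpow_one, inv_mul_cancel_left]; simp
    · simpa using key i j v r hv h1 h2 h3 h4
  · refine ⟨1, 0, (x ^ m)⁻¹ * y ^ 1 * x ^ i * u, r, by omega,
      mul_mem_syllables hi0 hi one_pos (by omega) hu, ?_⟩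
    simp [mul_assoc]

/-- The set of normal forms contains `1` and is stable under left multiplication by `x`, `y` and
`Δ⁻¹`, hence by `x⁻¹ = Δ⁻¹x^{m-1}` and `y⁻¹ = Δ⁻¹y^{n-1}`. -/
theorem mem_normalForms (hm : 2 ≤ m) (hn : 2 ≤ n) (hxy : x ^ m = y ^ n)
    (hgen : Subgroup.closure {x, y} = ⊤) (g : G) : g ∈ normalForms x y m n := by
  have hx : ∀ k : ℕ, ∀ g ∈ normalForms x y m n, x ^ k * g ∈ normalForms x y m n := by
    intro k
    induction k with
    | zero => simp
    | succ k ih => intro g hg; rw [pow_succ, mul_assoc]; exact ih _ (x_mul_mem_normalForms hm hg)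
  have hy : ∀ k : ℕ, ∀ g ∈ normalForms x y m n, y ^ k * g ∈ normalForms x y m n := by
    intro k
    induction k with
    | zero => simp
    | succ k ih =>
      intro g hg; rw [pow_succ, mul_assoc]; exact ih _ (y_mul_mem_normalForms hm hn hxy hg)
  have hD := fun g hg => zpow_mul_mem_normalForms (x := x) (y := y) (m := m) (n := n) (-1) (g := g) hg
  have key : ∀ h ∈ Subgroup.closure {x, y}, (∀ g ∈ normalForms x y m n, h * g ∈ normalForms x y m n) ∧
      ∀ g ∈ normalForms x y m n, h⁻¹ * g ∈ normalForms x y m n := by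
    intro h hh
    induction hh using Subgroup.closure_induction with
    | mem h hh =>
      rcases hh with rfl | rfl
      · refine ⟨fun g hg => x_mul_mem_normalForms hm hg, fun g hg => ?_⟩
        have := hD _ (hx (m - 1) g hg)
        rwa [← mul_assoc, show (h ^ m) ^ (-1 : ℤ) * h ^ (m - 1) = h⁻¹ by
          rw [show h ^ m = h ^ (m - 1) * h by rw [← pow_succ]; congr 1; omega]; simp] at this
      · refine ⟨fun g hg => y_mul_mem_normalForms hm hn hxy hg, fun g hg => ?_⟩
        have := hD _ (hy (n - 1) g hg)
        rwa [← mul_assoc, show (x ^ m) ^ (-1 : ℤ) * h ^ (n - 1) = h⁻¹ by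
          rw [hxy, show h ^ n = h ^ (n - 1) * h by rw [← pow_succ]; congr 1; omega]; simp] at this
    | one => simp
    | mul a b _ _ ha hb =>
      refine ⟨fun g hg => ?_, fun g hg => ?_⟩
      · rw [mul_assoc]; exact ha.1 _ (hb.1 _ hg)
      · rw [mul_inv_rev, mul_assoc]; exact hb.2 _ (ha.2 _ hg)
    | inv a _ ha => exact ⟨ha.2, by simpa using ha.1⟩
  have h1 : (1 : G) ∈ normalForms x y m n := ⟨0, 0, 1, 0, by omega, one_mem _, by simp⟩
  simpa using (key g (by rw [hgen]; trivial)).1 1 h1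

/-! ### Every element or its inverse lies in the monoid generated by `a`, `b`, `b⁻¹` -/

/-- The monoid generated by `a = x y x^{1-m}` and the powers of `b = x^{m-1} y⁻¹`. -/
def sigmaMonoid (x y : G) (m : ℕ) : Submonoid G :=
  Submonoid.closure {x * y * (x ^ (m - 1))⁻¹, x ^ (m - 1) * y⁻¹, (x ^ (m - 1) * y⁻¹)⁻¹}

theorem a_mem : x * y * (x ^ (m - 1))⁻¹ ∈ sigmaMonoid x y m :=
  Submonoid.subset_closure (by simp)

theorem b_mem : x ^ (m - 1) * y⁻¹ ∈ sigmaMonoid x y m :=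
  Submonoid.subset_closure (by simp)

theorem b_inv_mem : (x ^ (m - 1) * y⁻¹)⁻¹ ∈ sigmaMonoid x y m :=
  Submonoid.subset_closure (by simp)

theorem b_zpow_mem (k : ℤ) : (x ^ (m - 1) * y⁻¹) ^ k ∈ sigmaMonoid x y m := by
  cases k with
  | ofNat k => simpa using pow_mem b_mem k
  | negSucc k =>
    rw [zpow_negSucc, ← inv_pow]; exact pow_mem b_inv_mem _

theorem x_mem : x ∈ sigmaMonoid x y m := by
  have h := mul_mem (a_mem (x := x) (y := y) (m := m)) b_mem
  simpa [mul_assoc] using h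

theorem y_mem : y ∈ sigmaMonoid x y m := by
  have h := mul_mem (b_inv_mem (x := x) (y := y) (m := m)) (pow_mem x_mem (m - 1))
  simpa [mul_assoc] using h

/-- Because `Δ` is central and `b⁻¹ = yΔ⁻¹x`, the syllable equals `y^{j-1} b⁻¹ x^{i-1}`. -/
theorem y_pow_mul_x_pow_mem (hm : 2 ≤ m) (hxy : x ^ m = y ^ n) {i j : ℕ} (hi : 0 < i) (hj : 0 < j) :
    (x ^ m)⁻¹ * y ^ j * x ^ i ∈ sigmaMonoid x y m := by
  obtain ⟨i, rfl⟩ : ∃ k, i = k + 1 := ⟨i - 1, by omega⟩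
  obtain ⟨j, rfl⟩ : ∃ k, j = k + 1 := ⟨j - 1, by omega⟩
  have hc : Commute y (x ^ m) := by rw [hxy]; exact (Commute.refl y).pow_right n
  have h := mul_mem (mul_mem (pow_mem (y_mem (x := x) (y := y) (m := m)) j) b_inv_mem)
    (pow_mem x_mem i)
  convert h using 1
  rw [← (hc.inv_right.pow_left (j + 1)).eq,
    show x ^ m = x * x ^ (m - 1) by rw [← pow_succ']; congr 1; omega]
  simp only [mul_inv_rev, inv_inv, pow_succ y, pow_succ' x, ← mul_assoc]
  simp [mul_assoc]

theorem syllables_le (hm : 2 ≤ m) (hxy : x ^ m = y ^ n) :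
    syllables x y m n ≤ sigmaMonoid x y m := by
  rw [syllables, Submonoid.closure_le]
  rintro g ⟨i, j, hi, -, hj, -, rfl⟩
  exact y_pow_mul_x_pow_mem hm hxy hi hj

/-- Prefixing a syllable to `u` multiplies `Δu⁻¹` on the right by `Δ⁻¹ x^{m-i} y^{n-j}`. The
trailing `y^k` with `k > 0` is carried through the induction because it combines with `Δ⁻¹ x^{m-i}`
into an element of the monoid and leaves a new trailing power `y^{n-j}`. -/
theorem mul_inv_syllables_cases (hm : 2 ≤ m) (hxy : x ^ m = y ^ n) {u : G}
    (hu : u ∈ syllables x y m n) :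
    u = 1 ∨ ∃ v ∈ sigmaMonoid x y m, ∃ j : ℕ, 0 < j ∧ x ^ m * u⁻¹ = v * y ^ j := by
  induction hu using Submonoid.closure_induction_left with
  | one => exact Or.inl rfl
  | mul_left g hg u hu ih =>
    right
    obtain ⟨i, j, hi, hi', hj, hj', rfl⟩ := hg
    have hc : Commute y (x ^ m) := by rw [hxy]; exact (Commute.refl y).pow_right n
    have ex : (x ^ i)⁻¹ = (x ^ m)⁻¹ * x ^ (m - i) := by
      rw [eq_inv_mul_iff_mul_eq, ← div_eq_mul_inv, div_eq_iff_eq_mul, ← pow_add]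
      congr 1; omega
    have ey : (y ^ j)⁻¹ * x ^ m = y ^ (n - j) := by
      rw [inv_mul_eq_iff_eq_mul, hxy, ← pow_add]; congr 1; omega
    have e : x ^ m * ((x ^ m)⁻¹ * y ^ j * x ^ i * u)⁻¹ =
        x ^ m * u⁻¹ * (x ^ m)⁻¹ * x ^ (m - i) * y ^ (n - j) := by
      rw [← ey]; simp only [mul_inv_rev, inv_inv, ex, mul_assoc]
    rw [e]
    rcases ih with rfl | ⟨v, hv, k, hk, h⟩
    · exact ⟨x ^ (m - i), pow_mem x_mem _, n - j, by omega, by simp⟩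
    · refine ⟨v * ((x ^ m)⁻¹ * y ^ k * x ^ (m - i)),
        mul_mem hv (y_pow_mul_x_pow_mem hm hxy (by omega) hk), n - j, by omega, ?_⟩
      rw [h, ← (hc.inv_right.pow_left k).eq]; simp only [mul_assoc]

theorem mul_inv_x_pow_mul_mem (hm : 2 ≤ m) (hxy : x ^ m = y ^ n) {u : G} {i : ℕ} (hi : i < m)
    (hu : u ∈ syllables x y m n) : x ^ m * (x ^ i * u)⁻¹ ∈ sigmaMonoid x y m := by
  have hc : Commute y (x ^ m) := by rw [hxy]; exact (Commute.refl y).pow_right n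
  have ex : (x ^ i)⁻¹ = (x ^ m)⁻¹ * x ^ (m - i) := by
    rw [eq_inv_mul_iff_mul_eq, ← div_eq_mul_inv, div_eq_iff_eq_mul, ← pow_add]
    congr 1; omega
  rw [mul_inv_rev, ← mul_assoc]
  rcases mul_inv_syllables_cases hm hxy hu with rfl | ⟨v, hv, k, hk, h⟩
  · rw [ex]; simpa using pow_mem x_mem _
  · rcases Nat.eq_zero_or_pos i with rfl | hi0
    · simpa [h] using mul_mem hv (pow_mem y_mem k)
    · rw [h, ex, mul_assoc, ← mul_assoc (y ^ k), (hc.inv_right.pow_left k).eq]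
      exact mul_mem hv (y_pow_mul_x_pow_mem hm hxy (by omega) hk)

theorem mem_sigmaMonoid_or_inv_mem (hm : 2 ≤ m) (hn : 2 ≤ n) (hxy : x ^ m = y ^ n)
    (hgen : Subgroup.closure {x, y} = ⊤) (g : G) :
    g ∈ sigmaMonoid x y m ∨ g⁻¹ ∈ sigmaMonoid x y m := by
  obtain ⟨k, i, u, r, hi, hu, rfl⟩ := mem_normalForms hm hn hxy hgen g
  rcases le_or_gt 0 k with hk | hk
  · left
    lift k to ℕ using hk
    rw [zpow_natCast]
    exact mul_mem (mul_mem (mul_mem (pow_mem (pow_mem x_mem _) _) (pow_mem x_mem _))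
      (syllables_le hm hxy hu)) (b_zpow_mem r)
  · right
    -- Of the `l + 1` factors `Δ` in the inverse, one is reserved to compensate `(x^i u)⁻¹`.
    obtain ⟨l, rfl⟩ : ∃ l : ℕ, k = -(l + 1 : ℕ) := ⟨(-k - 1).toNat, by omega⟩
    have hxc : x ^ m ∈ Subgroup.center G := by
      rw [← Subgroup.centralizer_univ, ← Subgroup.coe_top, ← hgen, Subgroup.centralizer_closure,
        Subgroup.mem_centralizer_iff]
      rintro h (rfl | rfl)
      · exact ((Commute.refl h).pow_right m)
      · rw [hxy]; exact ((Commute.refl h).pow_right n)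
    have e : ((x ^ m) ^ (-(l + 1 : ℕ) : ℤ) * x ^ i * u * (x ^ (m - 1) * y⁻¹) ^ r)⁻¹ =
        (x ^ (m - 1) * y⁻¹) ^ (-r) * (x ^ m * (x ^ i * u)⁻¹) * (x ^ m) ^ l := by
      rw [mul_assoc _ (x ^ i) u, mul_inv_rev, mul_inv_rev, ← zpow_neg, ← zpow_neg, neg_neg,
        zpow_natCast, pow_succ', (Subgroup.mem_center_iff.1 hxc (x ^ i * u)⁻¹).symm]
      simp only [mul_assoc]
    rw [e]
    exact mul_mem (mul_mem (b_zpow_mem _) (mul_inv_x_pow_mul_mem hm hxy hi hu))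
      (pow_mem (pow_mem x_mem _) _)

end Trichotomy

/-! ### From the monoid to positive words -/

section Words

variable {G : Type*} [Group G]

theorem wordEval_append {k : ℕ} (S : Fin k → G) (v w : List (Fin k × Bool)) :
    wordEval S (v ++ w) = wordEval S v * wordEval S w := by
  simp [wordEval]

theorem wordEval_replicate {k : ℕ} (S : Fin k → G) (i : Fin k) (b : Bool) (r : ℕ) :
    wordEval S (List.replicate r (i, b)) = (if b then S i else (S i)⁻¹) ^ r := by
  simp [wordEval]

/-- The dichotomy is whether the letter `s₁` occurs in a product of generators; if it does not, only
a power of `s₂` remains. -/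
theorem exists_positiveWord_or_zpow (S : Fin 2 → G) {g : G}
    (hg : g ∈ Submonoid.closure {S 0, S 1, (S 1)⁻¹}) :
    (∃ w, IsPositiveWord 0 w ∧ wordEval S w = g) ∨ ∃ k : ℤ, g = S 1 ^ k := by
  induction hg using Submonoid.closure_induction_left with
  | one => exact Or.inr ⟨0, by simp⟩
  | mul_left s hs g hg ih =>
    have hcons : ∀ b : Bool, (∃ w, IsPositiveWord 0 w ∧ wordEval S w = g) →
        ∃ w, IsPositiveWord 0 w ∧ wordEval S w = (if b then S 1 else (S 1)⁻¹) * g := by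
      rintro b ⟨w, ⟨h1, h2⟩, rfl⟩
      exact ⟨(1, b) :: w, ⟨List.mem_cons_of_mem _ h1, by simpa using h2⟩, by simp [wordEval]⟩
    rcases hs with rfl | rfl | rfl
    · left
      rcases ih with ⟨w, ⟨h1, h2⟩, rfl⟩ | ⟨k, rfl⟩
      · exact ⟨(0, true) :: w, ⟨by simp, by simpa using h2⟩, by simp [wordEval]⟩
      · rcases Int.eq_nat_or_neg k with ⟨r, rfl | rfl⟩
        · refine ⟨(0, true) :: List.replicate r (1, true), ⟨by simp, ?_⟩, ?_⟩
          · intro p hp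
            rcases List.mem_cons.1 hp with rfl | hp
            · simp
            · rw [List.eq_of_mem_replicate hp]; simp
          · rw [← List.singleton_append, wordEval_append, wordEval_replicate]; simp [wordEval]
        · refine ⟨(0, true) :: List.replicate r (1, false), ⟨by simp, ?_⟩, ?_⟩
          · intro p hp
            rcases List.mem_cons.1 hp with rfl | hp
            · simp
            · rw [List.eq_of_mem_replicate hp]; simp
          · rw [← List.singleton_append, wordEval_append, wordEval_replicate]; simp [wordEval]
    · rcases ih with h | ⟨k, rfl⟩
      · exact Or.inl (by simpa using hcons true h)
      · exact Or.inr ⟨1 + k, by rw [zpow_add, zpow_one]⟩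
    · rcases ih with h | ⟨k, rfl⟩
      · exact Or.inl (by simpa using hcons false h)
      · exact Or.inr ⟨-1 + k, by rw [zpow_add, zpow_neg_one]⟩

theorem pow_mem_sigmaPositive {k : ℕ} (S : Fin k → G) (i : Fin k) {r : ℕ} (hr : 0 < r) :
    S i ^ r ∈ sigmaPositive S := by
  refine ⟨i, List.replicate r (i, true), ⟨by simp; omega, fun p hp => ?_⟩, ?_⟩
  · rw [List.eq_of_mem_replicate hp]; simp
  · rw [wordEval_replicate]; simp

theorem sigmaPositive_trichotomy_of_mem (S : Fin 2 → G) {g : G}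
    (hg : g ∈ Submonoid.closure {S 0, S 1, (S 1)⁻¹}) :
    g ∈ sigmaPositive S ∨ g = 1 ∨ g⁻¹ ∈ sigmaPositive S := by
  rcases exists_positiveWord_or_zpow S hg with ⟨w, hw, rfl⟩ | ⟨k, rfl⟩
  · exact Or.inl ⟨0, w, hw, rfl⟩
  · rcases Int.eq_nat_or_neg k with ⟨r, rfl | rfl⟩ <;> rcases Nat.eq_zero_or_pos r with rfl | hr
    · simp
    · exact Or.inl (by simpa using pow_mem_sigmaPositive S 1 hr)
    · simp
    · exact Or.inr (Or.inr (by simpa using pow_mem_sigmaPositive S 1 hr))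

end Words

/-! ### Generation and trichotomy in `G_{m,n}` -/

section Gmn

variable {m n : ℕ}

theorem x_pow_eq_y_pow (m n : ℕ) : x m n ^ m = y m n ^ n := by
  have h : PresentedGroup.mk ({FreeGroup.of 0 ^ m * (FreeGroup.of 1 ^ n)⁻¹} :
      Set (FreeGroup (Fin 2))) (FreeGroup.of 0 ^ m * (FreeGroup.of 1 ^ n)⁻¹) = 1 :=
    PresentedGroup.one_of_mem (by simp)
  rw [map_mul, map_inv, map_pow, map_pow, mul_inv_eq_one] at h
  exact h

theorem closure_x_y (m n : ℕ) : Subgroup.closure {x m n, y m n} = ⊤ := by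
  rw [← PresentedGroup.closure_range_of]
  congr 1
  ext g
  simp [x, y, eq_comm]

theorem S_zero (hm : 2 ≤ m) : S m n 0 = x m n * y m n * (x m n ^ (m - 1))⁻¹ := by
  have h : (-(m : ℤ) + 1) = -((m - 1 : ℕ) : ℤ) := by
    push_cast [Nat.cast_sub (show 1 ≤ m by omega)]; ring
  simp only [S, Matrix.cons_val_zero, h, zpow_neg, zpow_natCast]

theorem S_one (hm : 2 ≤ m) : S m n 1 = x m n ^ (m - 1) * (y m n)⁻¹ := by
  have h : ((m : ℤ) - 1) = ((m - 1 : ℕ) : ℤ) := by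
    push_cast [Nat.cast_sub (show 1 ≤ m by omega)]; ring
  simp only [S, Matrix.cons_val_one, Matrix.cons_val_fin_one, h, zpow_natCast]

theorem closure_S (hm : 2 ≤ m) : Subgroup.closure (Set.range (S m n)) = ⊤ := by
  have hx : x m n ∈ Subgroup.closure (Set.range (S m n)) := by
    have h := mul_mem (Subgroup.subset_closure (Set.mem_range_self 0))
      (Subgroup.subset_closure (k := Set.range (S m n)) (Set.mem_range_self 1))
    rw [S_zero hm, S_one hm] at h
    simpa [mul_assoc] using h
  have hy : y m n ∈ Subgroup.closure (Set.range (S m n)) := by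
    have h := mul_mem (inv_mem (Subgroup.subset_closure (k := Set.range (S m n))
      (Set.mem_range_self 1))) (pow_mem hx (m - 1))
    rw [S_one hm] at h
    simpa [mul_assoc] using h
  rw [eq_top_iff, ← closure_x_y, Subgroup.closure_le]
  rintro g (rfl | rfl)
  exacts [hx, hy]

theorem sigmaPositive_trichotomy (hm : 2 ≤ m) (hn : 2 ≤ n) (g : Gmn m n) :
    g ∈ sigmaPositive (S m n) ∨ g = 1 ∨ g⁻¹ ∈ sigmaPositive (S m n) := by
  have hM : sigmaMonoid (x m n) (y m n) m = Submonoid.closure {S m n 0, S m n 1, (S m n 1)⁻¹} := by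
    rw [S_zero hm, S_one hm, sigmaMonoid]
  rcases mem_sigmaMonoid_or_inv_mem hm hn (x_pow_eq_y_pow m n) (closure_x_y m n) g with h | h
  · exact sigmaPositive_trichotomy_of_mem _ (hM ▸ h)
  · have := sigmaPositive_trichotomy_of_mem _ (hM ▸ h)
    rw [inv_inv, inv_eq_one] at this
    tauto

end Gmn

/-! ### The orderings defined by points of the line -/

section LtOfPoints

variable {G : Type*} [Group G] (Θ : G →* (ℝ ≃o ℝ))

theorem action_mul (g h : G) (t : ℝ) : Θ (g * h) t = Θ g (Θ h t) := by
  rw [map_mul]; rfl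

theorem action_one (t : ℝ) : Θ 1 t = t := by
  rw [map_one]; rfl

theorem action_inv_apply (g : G) (t : ℝ) : Θ g⁻¹ (Θ g t) = t := by
  rw [← action_mul, inv_mul_cancel, action_one]

theorem ltOfPoints_mul_left {k : ℕ} (p : Fin k → ℝ) (h g g' : G) (hg : ltOfPoints Θ p g g') :
    ltOfPoints Θ p (h * g) (h * g') := by
  obtain ⟨j, h1, h2⟩ := hg
  exact ⟨j, fun i hi => by rw [action_mul, action_mul, h1 i hi],
    by rw [action_mul, action_mul]; exact (Θ h).strictMono h2⟩

theorem ltOfPoints_irrefl {k : ℕ} (p : Fin k → ℝ) (g : G) : ¬ ltOfPoints Θ p g g :=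
  fun ⟨_, _, h⟩ => lt_irrefl _ h

theorem ltOfPoints_trans {k : ℕ} (p : Fin k → ℝ) (g h l : G) (h1 : ltOfPoints Θ p g h)
    (h2 : ltOfPoints Θ p h l) : ltOfPoints Θ p g l := by
  obtain ⟨i, hi, hi'⟩ := h1
  obtain ⟨j, hj, hj'⟩ := h2
  rcases lt_trichotomy i j with hij | rfl | hij
  · exact ⟨i, fun a ha => (hi a ha).trans (hj a (ha.trans hij)), hi'.trans_eq (hj i hij)⟩
  · exact ⟨i, fun a ha => (hi a ha).trans (hj a ha), hi'.trans hj'⟩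
  · exact ⟨j, fun a ha => (hi a (ha.trans hij)).trans (hj a ha), (hi j hij).trans_lt hj'⟩

/-- If every `σ(S)`-positive element moves the sequence of points up, and every nontrivial element
is `σ(S)`-positive or `σ(S)`-negative, then the two relations agree. -/
theorem ltOfPoints_iff_dehornoyLT {k l : ℕ} (p : Fin k → ℝ) (S : Fin l → G)
    (htri : ∀ g, g ∈ sigmaPositive S ∨ g = 1 ∨ g⁻¹ ∈ sigmaPositive S)
    (hpos : ∀ g ∈ sigmaPositive S, ltOfPoints Θ p 1 g) (g h : G) :
    ltOfPoints Θ p g h ↔ dehornoyLT S g h := by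
  constructor
  · intro hgh
    have h1 : ltOfPoints Θ p 1 (g⁻¹ * h) := by
      simpa using ltOfPoints_mul_left Θ p g⁻¹ _ _ hgh
    rcases htri (g⁻¹ * h) with h2 | h2 | h2
    · exact h2
    · rw [h2] at h1; exact absurd h1 (ltOfPoints_irrefl Θ p 1)
    · have h3 := ltOfPoints_mul_left Θ p (g⁻¹ * h) _ _ (hpos _ h2)
      rw [mul_one, mul_inv_cancel] at h3
      exact absurd (ltOfPoints_trans Θ p _ _ _ h1 h3) (ltOfPoints_irrefl Θ p 1)
  · intro hgh
    simpa using ltOfPoints_mul_left Θ p g _ _ (hpos _ hgh)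

/-- Only totality needs an argument: distinct elements could agree at all the given points, and the
trichotomy excludes this. -/
theorem isLeftOrdering_ltOfPoints {k l : ℕ} (p : Fin k → ℝ) (S : Fin l → G)
    (htri : ∀ g, g ∈ sigmaPositive S ∨ g = 1 ∨ g⁻¹ ∈ sigmaPositive S)
    (hpos : ∀ g ∈ sigmaPositive S, ltOfPoints Θ p 1 g) : IsLeftOrdering (ltOfPoints Θ p) where
  irrefl := ltOfPoints_irrefl Θ p
  trans := ltOfPoints_trans Θ p
  mul_left := ltOfPoints_mul_left Θ p
  total g h := by
    rcases htri (g⁻¹ * h) with h1 | h1 | h1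
    · exact Or.inl ((ltOfPoints_iff_dehornoyLT Θ p S htri hpos g h).2 h1)
    · exact Or.inr (Or.inl (inv_mul_eq_one.1 h1))
    · refine Or.inr (Or.inr ((ltOfPoints_iff_dehornoyLT Θ p S htri hpos h g).2 ?_))
      simpa [dehornoyLT] using h1

/-- The letters act from right to left. Those of `s₂^{±1}` fix `E`, so they preserve both `E ≤ t`
and `E < t`; a letter `s₁` turns the weak inequality into the strict one. -/
theorem le_wordEval {S : Fin 2 → G} {E : ℝ} (h0 : E < Θ (S 0) E) (h1 : Θ (S 1) E = E)
    (w : List (Fin 2 × Bool)) (hw : ∀ p ∈ w, p ≠ (0, false)) :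
    E ≤ Θ (wordEval S w) E ∧ ((0, true) ∈ w → E < Θ (wordEval S w) E) := by
  have h1' : Θ (S 1)⁻¹ E = E := by
    conv_lhs => rw [← h1]
    exact action_inv_apply Θ _ _
  induction w with
  | nil => simp [wordEval]
  | cons p w ih =>
    obtain ⟨ih1, ih2⟩ := ih fun q hq => hw q (List.mem_cons_of_mem _ hq)
    have e : wordEval S (p :: w) = (if p.2 then S p.1 else (S p.1)⁻¹) * wordEval S w := by
      simp [wordEval]
    rw [e, action_mul]
    have hp := hw p List.mem_cons_self
    obtain ⟨i, b⟩ := p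
    fin_cases i <;> cases b
    · exact absurd rfl hp
    · have := h0.trans_le ((Θ (S 0)).monotone ih1)
      exact ⟨this.le, fun _ => this⟩
    · refine ⟨h1'.symm.le.trans ((Θ (S 1)⁻¹).monotone ih1), fun h => ?_⟩
      exact h1'.symm.trans_lt ((Θ (S 1)⁻¹).strictMono (ih2 (by simpa using h)))
    · refine ⟨h1.symm.le.trans ((Θ (S 1)).monotone ih1), fun h => ?_⟩
      exact h1.symm.trans_lt ((Θ (S 1)).strictMono (ih2 (by simpa using h)))

/-- The point `E` detects words containing `s₁`. The remaining positive elements are the powers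
`s₂^r` with `r > 0`, which fix `E` and are detected by `F`. -/
theorem ltOfPoints_one_of_mem_sigmaPositive {S : Fin 2 → G} {E F : ℝ} (h0 : E < Θ (S 0) E)
    (h1 : Θ (S 1) E = E) (hF : F < Θ (S 1) F) {g : G} (hg : g ∈ sigmaPositive S) :
    ltOfPoints Θ ![E, F] 1 g := by
  obtain ⟨i, w, ⟨hi, hw⟩, rfl⟩ := hg
  fin_cases i
  · exact ⟨0, by simp, by
      simpa [action_one] using (le_wordEval Θ h0 h1 w fun p hp => (hw p hp).2).2 hi⟩
  · have hw' : ∀ p ∈ w, p = ((1 : Fin 2), true) := by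
      rintro ⟨i, b⟩ hp
      obtain ⟨h2, h3⟩ := hw _ hp
      fin_cases i
      · simp at h2
      · cases b
        · simp at h3
        · rfl
    obtain ⟨r, hr⟩ : ∃ r, w = List.replicate r ((1 : Fin 2), true) :=
      ⟨w.length, List.eq_replicate_of_mem hw'⟩
    have key : ∀ r : ℕ, Θ (S 1 ^ r) E = E ∧ (0 < r → F < Θ (S 1 ^ r) F) := by
      intro r
      induction r with
      | zero => simp
      | succ r ih =>
        rw [pow_succ', action_mul, action_mul, ih.1]
        refine ⟨h1, fun _ => ?_⟩
        rcases Nat.eq_zero_or_pos r with rfl | h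
        · simpa [action_one] using hF
        · exact hF.trans ((Θ (S 1)).strictMono (ih.2 h))
    have hr0 : 0 < r := by
      rcases Nat.eq_zero_or_pos r with rfl | h
      · rw [hr] at hi; simp at hi
      · exact h
    rw [hr, wordEval_replicate]
    refine ⟨1, fun i hi => ?_, by simpa [action_one] using (key r).2 hr0⟩
    obtain rfl : i = 0 := by fin_cases i <;> simp_all
    simpa [action_one] using (key r).1.symm

end LtOfPoints

/-! ### The points `E` and `F` under a standard action -/

namespace Code

variable {m n : ℕ}

theorem side_ones (hm : 2 ≤ m) (hn : 2 ≤ n) (s : Bool) (k : ℕ) :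
    (ones hm hn (!s)).side k = (ones hm hn s).side (k + 1) := by
  rw [side_succ]; cases s <;> simp [side, ones]

theorem edge_ones (hm : 2 ≤ m) (hn : 2 ≤ n) (s : Bool) (k : ℕ) :
    letter m n s * (ones hm hn (!s)).edge k = (ones hm hn s).edge (k + 1) := by
  induction k with
  | zero => simp [edge, ones, side]
  | succ k ih => rw [edge, ← mul_assoc, ih, edge, side_ones]; rfl

/-- The translated ray is the ray of the other constant code with its first step removed, so `X` and
`Y` exchange the two ends in the directions `- ↦ +` and `+ ↦ -`. -/
theorem letter_smul_ones (hm : 2 ≤ m) (hn : 2 ≤ n) (s : Bool) :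
    Ends.smul (letter m n s) (ones hm hn (!s)).toEnd = (ones hm hn s).toEnd := by
  refine Quotient.sound ⟨0, 1, fun k => ?_⟩
  change letter m n s • vert _ _ = vert _ _
  rw [smul_vert, edge_ones, side_ones]
  congr 2 <;> ring_nf

end Code

namespace StandardAction

variable {m n : ℕ} (A : StandardAction m n)

theorem proj_x : proj m n (x m n) = letter m n true := by
  simp [proj, x, letter]

theorem proj_y : proj m n (y m n) = letter m n false := by
  simp [proj, y, letter]

theorem central_y (t : ℝ) : A.Θ (y m n ^ n) t = t + 1 := by
  rw [← x_pow_eq_y_pow]; exact A.central t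

theorem map_add_one (g : Gmn m n) (t : ℝ) : A.Θ g (t + 1) = A.Θ g t + 1 := by
  have hc : x m n ^ m ∈ Subgroup.center (Gmn m n) := by
    rw [← Subgroup.centralizer_univ, ← Subgroup.coe_top, ← closure_x_y, Subgroup.centralizer_closure,
      Subgroup.mem_centralizer_iff]
    rintro h (rfl | rfl)
    · exact ((Commute.refl _).pow_right m)
    · rw [x_pow_eq_y_pow]; exact ((Commute.refl _).pow_right n)
  rw [← A.central t, ← A.central, ← action_mul, ← action_mul, Subgroup.mem_center_iff.1 hc]

/-- If `g t ≤ t`, all iterates of `t` stay at or below `t`, contrary to `g^k t = t + 1`. -/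
theorem lt_of_pow {g : Gmn m n} {k : ℕ} (h : ∀ t, A.Θ (g ^ k) t = t + 1) (t : ℝ) :
    t < A.Θ g t := by
  by_contra! hle
  have : ∀ j : ℕ, A.Θ (g ^ j) t ≤ t := by
    intro j
    induction j with
    | zero => simp
    | succ j ih => rw [pow_succ', action_mul]; exact ((A.Θ g).monotone ih).trans hle
  have := this k
  rw [h] at this
  linarith

theorem pow_lt_pow {g : Gmn m n} {k : ℕ} (h : ∀ t, A.Θ (g ^ k) t = t + 1) (t : ℝ) {i j : ℕ}
    (hij : i < j) : A.Θ (g ^ i) t < A.Θ (g ^ j) t := by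
  induction j, hij using Nat.le_induction with
  | base => rw [pow_succ', action_mul]; exact A.lt_of_pow h _
  | succ j _ ih => rw [pow_succ' g j, action_mul]; exact ih.trans (A.lt_of_pow h _)

variable {A}

/-- The action on ends determines `xE` and `yF` modulo `1`, and the inequalities `t < xt < t + 1`
and `t < yt < t + 1` select the lifts `xE = F` and `yF = E + 1`. The rest is computed from `ab = x`
and `byx = x^m`. -/
theorem points_action (hn : 2 ≤ n) (hm : 3 ≤ m) {O E F : ℝ}
    (hO : (O : AddCircle (1 : ℝ)) = A.ι (Code.ones (by omega) hn false).toEnd)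
    (hE : E = A.point O 0 (Code.ones (by omega) hn false))
    (hF : F = A.point O 0 (Code.ones (by omega) hn true)) :
    E < A.Θ (S m n 0) E ∧ A.Θ (S m n 1) E = E ∧ F < A.Θ (S m n 1) F := by
  have hm2 : 2 ≤ m := by omega
  have lift_unique : ∀ {a s t : ℝ}, s ∈ Set.Ico a (a + 1) → t ∈ Set.Ico a (a + 1) →
      (s : AddCircle (1 : ℝ)) = t → s = t := by
    intro a s t hs ht hst
    have := (AddCircle.equivIco (1 : ℝ) a).symm.injective (a₁ := ⟨s, hs⟩) (a₂ := ⟨t, ht⟩) hst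
    exact congrArg Subtype.val this
  have coe_point : ∀ c : Code m n, ((A.point O 0 c : ℝ) : AddCircle (1 : ℝ)) = A.ι c.toEnd :=
    fun c => (AddCircle.equivIco (1 : ℝ) (O + (0 : ℤ))).symm_apply_apply _
  have mem_point : ∀ c : Code m n, A.point O 0 c ∈ Set.Ico O (O + 1) := by
    intro c
    have := (AddCircle.equivIco (1 : ℝ) (O + (0 : ℤ)) (A.ι c.toEnd)).2
    simpa [StandardAction.point] using this
  have hEO : E = O := lift_unique (hE ▸ mem_point _) ⟨le_rfl, by linarith⟩
    (by rw [hE, coe_point, hO])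
  have ltx := A.lt_of_pow A.central
  have lty := A.lt_of_pow A.central_y
  have hcE : (E : AddCircle (1 : ℝ)) = A.ι (Code.ones hm2 hn false).toEnd := by rw [hE, coe_point]
  have hcF : (F : AddCircle (1 : ℝ)) = A.ι (Code.ones hm2 hn true).toEnd := by rw [hF, coe_point]
  have hxE : A.Θ (x m n) E = F := by
    refine lift_unique (a := E) ⟨(ltx E).le, ?_⟩ (by rw [hEO, hF]; exact mem_point _) ?_
    · have := A.pow_lt_pow A.central E (show 1 < m by omega)
      rwa [A.central, pow_one] at this
    · rw [A.lift, proj_x, hcE, A.extends_ends, hcF]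
      exact congrArg A.ι (Code.letter_smul_ones hm2 hn true)
  have hEF : E < F := hxE ▸ ltx E
  have hFE : F < E + 1 := by rw [hEO, hF]; exact (mem_point _).2
  have hyF : A.Θ (y m n) F = E + 1 := by
    have h1 : A.Θ (y m n) F < F + 1 := by
      have := A.pow_lt_pow A.central_y F (show 1 < n by omega)
      rwa [A.central_y, pow_one] at this
    have hc : ((A.Θ (y m n) F : ℝ) : AddCircle (1 : ℝ)) = ((E + 1 : ℝ) : AddCircle (1 : ℝ)) := by
      rw [A.lift, proj_y, hcF, A.extends_ends, AddCircle.coe_add_period, hcE]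
      exact congrArg A.ι (Code.letter_smul_ones hm2 hn false)
    exact lift_unique (a := F) ⟨(lty F).le, h1⟩ ⟨hFE.le, by linarith⟩ hc
  have inv_apply : ∀ {g : Gmn m n} {s t : ℝ}, A.Θ g s = t → A.Θ g⁻¹ t = s := by
    rintro g s _ rfl; exact action_inv_apply _ _ _
  -- Since `byx = x^m` is translation by `1`, the map `b` undoes `s ↦ yxs - 1`.
  have hb : ∀ {s t : ℝ}, A.Θ (y m n) (A.Θ (x m n) s) = t + 1 → A.Θ (S m n 1) t = s := by
    intro s t h
    have e : A.Θ (S m n 1) (t + 1) = s + 1 := by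
      rw [S_one hm2, action_mul, inv_apply h, ← action_mul, ← pow_succ,
        show m - 1 + 1 = m by omega, A.central]
    rw [A.map_add_one] at e
    linarith
  have h1 : A.Θ (S m n 1) E = E := hb (by rw [hxE, hyF])
  have h0 : A.Θ (S m n 0) E = F := by
    have e : S m n 0 * S m n 1 = x m n := by rw [S_zero hm2, S_one hm2]; simp [mul_assoc]
    rw [← h1, ← action_mul, e, hxE]
  refine ⟨h0 ▸ hEF, h1, ?_⟩
  -- The claim `F < bF` amounts to `yxF < F + 1`. Strictness comes from `xF = x²E < x^m E = E + 1`,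
  -- which needs `m ≥ 3`; then `yE ≤ F` follows by applying `y`, as `y²E ≤ y^n E = E + 1 = yF`.
  have key : A.Θ (y m n) (A.Θ (x m n) F) < F + 1 := by
    have hx2 : A.Θ (x m n) F < E + 1 := by
      have := A.pow_lt_pow A.central E (show 2 < m by omega)
      rwa [A.central, pow_two, action_mul, hxE] at this
    have hyE : A.Θ (y m n) E ≤ F := by
      refine (A.Θ (y m n)).le_iff_le.1 ?_
      rw [hyF, ← action_mul, ← A.central_y, ← pow_two]
      rcases hn.eq_or_lt with rfl | h
      · exact le_rfl
      · exact (A.pow_lt_pow A.central_y E h).le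
    have := (A.Θ (y m n)).strictMono hx2
    rw [A.map_add_one] at this
    linarith
  have h2 : A.Θ (S m n 1) (A.Θ (y m n) (A.Θ (x m n) F) - 1) = F := hb (by ring)
  calc F = A.Θ (S m n 1) (A.Θ (y m n) (A.Θ (x m n) F) - 1) := h2.symm
    _ < A.Θ (S m n 1) F := (A.Θ (S m n 1)).strictMono (by linarith)

end StandardAction

/-! ### Lifts of circle homeomorphisms -/

section Circle

/-- The orientation-preserving homeomorphisms of the line that commute with `t ↦ t + 1`. -/
def periodicIso : Subgroup (ℝ ≃o ℝ) where
  carrier := {f | ∀ t, f (t + 1) = f t + 1}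
  one_mem' _ := rfl
  mul_mem' {f g} hf hg t := by
    change f (g (t + 1)) = f (g t) + 1
    rw [hg, hf]
  inv_mem' {f} hf t := by
    change f.symm (t + 1) = f.symm t + 1
    rw [OrderIso.symm_apply_eq, hf, OrderIso.apply_symm_apply]

/-- The map of the circle induced by a periodic homeomorphism of the line. -/
noncomputable def circleMap (f : periodicIso) : AddCircle (1 : ℝ) → AddCircle (1 : ℝ) :=
  Function.Periodic.lift (f := fun t => ((f.1 t : ℝ) : AddCircle (1 : ℝ))) (c := 1) fun t => by
    change ((f.1 (t + 1) : ℝ) : AddCircle (1 : ℝ)) = f.1 t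
    rw [f.2 t, AddCircle.coe_add_period]

theorem circleMap_mul (f g : periodicIso) (z : AddCircle (1 : ℝ)) :
    circleMap (f * g) z = circleMap f (circleMap g z) := by
  induction z using QuotientAddGroup.induction_on with
  | H t => rfl

theorem circleMap_one (z : AddCircle (1 : ℝ)) : circleMap 1 z = z := by
  induction z using QuotientAddGroup.induction_on with
  | H t => rfl

theorem continuous_circleMap (f : periodicIso) : Continuous (circleMap f) :=
  continuous_coinduced_dom.2
    ((AddCircle.continuous_mk' (1 : ℝ)).comp f.1.toHomeomorph.continuous)

/-- The homeomorphism of the circle induced by a periodic homeomorphism of the line. -/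
noncomputable def circleHom : periodicIso →* (AddCircle (1 : ℝ) ≃ₜ AddCircle (1 : ℝ)) where
  toFun f :=
    { toFun := circleMap f
      invFun := circleMap f⁻¹
      left_inv := fun z => by rw [← circleMap_mul, inv_mul_cancel, circleMap_one]
      right_inv := fun z => by rw [← circleMap_mul, mul_inv_cancel, circleMap_one]
      continuous_toFun := continuous_circleMap f
      continuous_invFun := continuous_circleMap f⁻¹ }
  map_one' := by ext z; exact circleMap_one z
  map_mul' f g := by ext z; exact circleMap_mul f g z

theorem circleHom_coe (f : periodicIso) (t : ℝ) :
    circleHom f (t : AddCircle (1 : ℝ)) = ((f.1 t : ℝ) : AddCircle (1 : ℝ)) :=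
  rfl

theorem sbtw_coe_of_lt {a b c : ℝ} (hab : a < b) (hbc : b < c) (hca : c < a + 1) :
    sbtw (a : AddCircle (1 : ℝ)) (b : AddCircle (1 : ℝ)) (c : AddCircle (1 : ℝ)) := by
  rw [sbtw_iff_not_btw]
  change ¬ btw ((c : ℝ ⧸ AddSubgroup.zmultiples (1 : ℝ))) b a
  rw [QuotientAddGroup.btw_coe_iff, not_le,
    (toIocMod_eq_iff _ (c := a + 1)).2 ⟨⟨by linarith, by linarith⟩, -1, by simp⟩,
    (toIcoMod_eq_iff _ (c := b + 1)).2 ⟨⟨by linarith, by linarith⟩, -1, by simp⟩]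
  linarith

theorem exists_lt_of_sbtw {u v w : AddCircle (1 : ℝ)} (h : sbtw u v w) :
    ∃ a b c : ℝ, a < b ∧ b < c ∧ c < a + 1 ∧ (a : AddCircle (1 : ℝ)) = u ∧
      (b : AddCircle (1 : ℝ)) = v ∧ (c : AddCircle (1 : ℝ)) = w := by
  induction u using QuotientAddGroup.induction_on with
  | H a =>
  induction v using QuotientAddGroup.induction_on with
  | H b =>
  induction w using QuotientAddGroup.induction_on with
  | H c =>
  rw [sbtw_iff_not_btw] at h
  change ¬ btw ((c : ℝ ⧸ AddSubgroup.zmultiples (1 : ℝ))) b a at h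
  rw [QuotientAddGroup.btw_coe_iff, not_le] at h
  have h1 := toIocMod_mem_Ioc (one_pos : (0 : ℝ) < 1) c a
  have h2 := toIcoMod_mem_Ico (one_pos : (0 : ℝ) < 1) c b
  refine ⟨toIocMod one_pos c a, toIcoMod one_pos c b, c + 1, h, h2.2, by linarith [h1.1], ?_, ?_, ?_⟩
  · rw [← sub_eq_zero, ← AddCircle.coe_sub, AddCircle.coe_eq_zero_iff]
    exact ⟨-toIocDiv one_pos c a, by rw [← toIocMod_sub_self]⟩
  · rw [← sub_eq_zero, ← AddCircle.coe_sub, AddCircle.coe_eq_zero_iff]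
    exact ⟨-toIcoDiv one_pos c b, by rw [← toIcoMod_sub_self]⟩
  · exact AddCircle.coe_add_period _ _

/-- Three points are in strict cyclic order exactly when they have lifts `a < b < c < a + 1`, and
increasing maps commuting with `t ↦ t + 1` preserve such lifts. -/
theorem sbtw_circleHom (f : periodicIso) {u v w : AddCircle (1 : ℝ)} (h : sbtw u v w) :
    sbtw (circleHom f u) (circleHom f v) (circleHom f w) := by
  obtain ⟨a, b, c, hab, hbc, hca, rfl, rfl, rfl⟩ := exists_lt_of_sbtw h
  simp only [circleHom_coe]
  refine sbtw_coe_of_lt (f.1.strictMono hab) (f.1.strictMono hbc) ?_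
  rw [← f.2 a]
  exact f.1.strictMono hca

end Circle

/-! ### Periodic homeomorphisms from homeomorphisms of the interval -/

section FloorIso

/-- The periodic extension of a self-map of `[0, 1)`. -/
noncomputable def floorExt (ψ : ℝ → ℝ) (t : ℝ) : ℝ := ⌊t⌋ + ψ (Int.fract t)

theorem floorExt_of_mem (ψ : ℝ → ℝ) {t : ℝ} (ht : t ∈ Set.Ico (0 : ℝ) 1) : floorExt ψ t = ψ t := by
  rw [floorExt, Int.floor_eq_zero_iff.2 ht, Int.fract_eq_self.2 ht]; simp

theorem floorExt_add_one (ψ : ℝ → ℝ) (t : ℝ) : floorExt ψ (t + 1) = floorExt ψ t + 1 := by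
  simp only [floorExt, Int.floor_add_one, Int.fract_add_one, Int.cast_add, Int.cast_one]; ring

theorem floorExt_floorExt {ψ χ : ℝ → ℝ} (hψ : Set.MapsTo ψ (Set.Ico 0 1) (Set.Ico 0 1))
    (h : Set.LeftInvOn χ ψ (Set.Ico 0 1)) (t : ℝ) : floorExt χ (floorExt ψ t) = t := by
  have ht : Int.fract t ∈ Set.Ico (0 : ℝ) 1 := ⟨Int.fract_nonneg t, Int.fract_lt_one t⟩
  have h1 := hψ ht
  rw [floorExt, floorExt, Int.floor_intCast_add, Int.fract_intCast_add,
    Int.floor_eq_zero_iff.2 h1, Int.fract_eq_self.2 h1, h ht, add_zero, Int.floor_add_fract]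

theorem floorExt_monotone {ψ : ℝ → ℝ} (hψ : Set.MapsTo ψ (Set.Ico 0 1) (Set.Ico 0 1))
    (hmono : Monotone ψ) : Monotone (floorExt ψ) := by
  intro s t hst
  have hs := (hψ ⟨Int.fract_nonneg s, Int.fract_lt_one s⟩).2
  have ht := (hψ ⟨Int.fract_nonneg t, Int.fract_lt_one t⟩).1
  rcases (Int.floor_le_floor hst).eq_or_lt with h | h
  · simp only [floorExt, h]
    gcongr
    apply hmono
    simp only [Int.fract, h]
    linarith
  · have h' : (⌊s⌋ : ℝ) + 1 ≤ ⌊t⌋ := by exact_mod_cast h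
    simp only [floorExt]
    linarith

/-- The periodic homeomorphism of the line extending a homeomorphism of `[0, 1)`. -/
noncomputable def floorIso (ψ χ : ℝ → ℝ) (hψ : Set.MapsTo ψ (Set.Ico 0 1) (Set.Ico 0 1))
    (hχ : Set.MapsTo χ (Set.Ico 0 1) (Set.Ico 0 1)) (h : Set.InvOn χ ψ (Set.Ico 0 1) (Set.Ico 0 1))
    (mψ : Monotone ψ) (mχ : Monotone χ) : ℝ ≃o ℝ where
  toFun := floorExt ψ
  invFun := floorExt χ
  left_inv := floorExt_floorExt hψ h.1
  right_inv := floorExt_floorExt hχ h.2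
  map_rel_iff' {s t} := by
    refine ⟨fun hst => ?_, fun hst => floorExt_monotone hψ mψ hst⟩
    have := floorExt_monotone hχ mχ hst
    simpa [floorExt_floorExt hψ h.1] using this

end FloorIso

/-! ### A pair of periodic homeomorphisms with `x ^ m = y ^ n = (t ↦ t + 1)` -/

section Generators

/-- A translation of the line. -/
noncomputable def translation (a : ℝ) : periodicIso :=
  ⟨OrderIso.addRight a, fun t => by simp only [OrderIso.addRight_apply]; ring⟩

theorem translation_apply (a t : ℝ) : (translation a).1 t = t + a := rfl

theorem translation_pow_apply (a : ℝ) (k : ℕ) (t : ℝ) : (translation a ^ k).1 t = t + k * a := by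
  induction k generalizing t with
  | zero => simp
  | succ k ih =>
    rw [pow_succ]
    change (translation a ^ k).1 ((translation a).1 t) = _
    rw [ih, translation_apply]; push_cast; ring

/-- The expanding-contracting piecewise linear homeomorphism of `[0, 1]`, which maps `1 / n` to
`m / (m + 1)`. -/
noncomputable def bend (m n : ℕ) (s : ℝ) : ℝ :=
  min (n * m / (m + 1) * s) (1 - n / ((n - 1) * (m + 1)) * (1 - s))

/-- The inverse of `bend`. -/
noncomputable def unbend (m n : ℕ) (s : ℝ) : ℝ :=
  max (s / (n * m / (m + 1))) (1 - (1 - s) / (n / ((n - 1) * (m + 1))))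

variable {m n : ℕ}

theorem slope_pos (hm : 2 ≤ m) (hn : 2 ≤ n) :
    0 < (n * m / (m + 1) : ℝ) ∧ 0 < (n / ((n - 1) * (m + 1)) : ℝ) := by
  have h1 : (2 : ℝ) ≤ m := by exact_mod_cast hm
  have h2 : (2 : ℝ) ≤ n := by exact_mod_cast hn
  have h3 : (0 : ℝ) < n - 1 := by linarith
  constructor <;> positivity

theorem bend_strictMono (hm : 2 ≤ m) (hn : 2 ≤ n) : StrictMono (bend m n) := by
  obtain ⟨h1, h2⟩ := slope_pos hm hn
  intro s t hst
  exact min_lt_min (mul_lt_mul_of_pos_left hst h1)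
    (by have := mul_lt_mul_of_pos_left (show 1 - t < 1 - s by linarith) h2; linarith)

theorem unbend_bend (hm : 2 ≤ m) (hn : 2 ≤ n) (s : ℝ) : unbend m n (bend m n s) = s := by
  obtain ⟨h1, h2⟩ := slope_pos hm hn
  unfold bend unbend
  generalize (n * m / (m + 1) : ℝ) = K at *
  generalize (n / ((n - 1) * (m + 1)) : ℝ) = κ at *
  rcases le_total (K * s) (1 - κ * (1 - s)) with h | h
  · rw [min_eq_left h, max_eq_left]
    · field_simp
    · rw [mul_div_cancel_left₀ _ h1.ne', sub_le_comm, le_div_iff₀ h2]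
      linarith
  · rw [min_eq_right h, max_eq_right]
    · field_simp; ring
    · rw [sub_sub_cancel, mul_div_cancel_left₀ _ h2.ne', div_le_iff₀ h1]
      linarith

theorem bend_unbend (hm : 2 ≤ m) (hn : 2 ≤ n) (s : ℝ) : bend m n (unbend m n s) = s := by
  obtain ⟨h1, h2⟩ := slope_pos hm hn
  unfold bend unbend
  generalize (n * m / (m + 1) : ℝ) = K at *
  generalize (n / ((n - 1) * (m + 1)) : ℝ) = κ at *
  rcases le_total (s / K) (1 - (1 - s) / κ) with h | h
  · have h' := (div_le_iff₀ h1).1 h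
    rw [max_eq_right h, min_eq_right]
    · field_simp; ring
    · rw [sub_sub_cancel, mul_div_cancel₀ _ h2.ne']; linarith
  · have h' := (le_div_iff₀ h2).1 (sub_le_comm.1 h)
    rw [max_eq_left h, min_eq_left]
    · field_simp
    · rw [mul_div_cancel₀ _ h1.ne']; linarith

theorem bend_zero (hm : 2 ≤ m) (hn : 2 ≤ n) : bend m n 0 = 0 := by
  have h1 : (2 : ℝ) ≤ m := by exact_mod_cast hm
  have h2 : (2 : ℝ) ≤ n := by exact_mod_cast hn
  have h3 : (0 : ℝ) < n - 1 := by linarith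
  rw [bend, mul_zero, min_eq_left]
  rw [sub_zero, mul_one, sub_nonneg, div_le_one (by positivity)]
  nlinarith

theorem bend_one (hm : 2 ≤ m) (hn : 2 ≤ n) : bend m n 1 = 1 := by
  have h1 : (2 : ℝ) ≤ m := by exact_mod_cast hm
  have h2 : (2 : ℝ) ≤ n := by exact_mod_cast hn
  rw [bend, mul_one, sub_self, mul_zero, sub_zero, min_eq_right]
  rw [one_le_div (by positivity)]
  nlinarith

theorem unbend_strictMono (hm : 2 ≤ m) (hn : 2 ≤ n) : StrictMono (unbend m n) := by
  intro s t hst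
  rw [← (bend_strictMono hm hn).lt_iff_lt, bend_unbend hm hn, bend_unbend hm hn]
  exact hst

/-- The periodic extension of `bend`. -/
noncomputable def bendIso (hm : 2 ≤ m) (hn : 2 ≤ n) : periodicIso :=
  ⟨floorIso (bend m n) (unbend m n)
    (fun s hs => ⟨(bend_zero hm hn).symm.le.trans ((bend_strictMono hm hn).monotone hs.1),
      ((bend_strictMono hm hn) hs.2).trans_eq (bend_one hm hn)⟩)
    (fun s hs => by
      have h0 : unbend m n 0 = 0 := by
        conv_lhs => rw [← bend_zero hm hn]
        exact unbend_bend hm hn 0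
      have h1 : unbend m n 1 = 1 := by
        conv_lhs => rw [← bend_one hm hn]
        exact unbend_bend hm hn 1
      exact ⟨h0.symm.le.trans ((unbend_strictMono hm hn).monotone hs.1),
        ((unbend_strictMono hm hn) hs.2).trans_eq h1⟩)
    ⟨fun s _ => unbend_bend hm hn s, fun s _ => bend_unbend hm hn s⟩
    (bend_strictMono hm hn).monotone (unbend_strictMono hm hn).monotone,
    floorExt_add_one _⟩

theorem bendIso_apply (hm : 2 ≤ m) (hn : 2 ≤ n) {s : ℝ} (hs : s ∈ Set.Ico (0 : ℝ) 1) :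
    (bendIso hm hn).1 s = bend m n s :=
  floorExt_of_mem _ hs

/-- The homeomorphisms of the line by which `x` and `y` act. -/
noncomputable def generator (hm : 2 ≤ m) (hn : 2 ≤ n) (b : Bool) : periodicIso :=
  if b then translation (1 / m)
  else bendIso hm hn * translation (1 / n) * (bendIso hm hn)⁻¹

theorem generator_false_pow (hm : 2 ≤ m) (hn : 2 ≤ n) (k : ℕ) :
    generator hm hn false ^ k = bendIso hm hn * translation (1 / n) ^ k * (bendIso hm hn)⁻¹ := by
  simp only [generator, Bool.false_eq_true, if_false, conj_pow]

theorem generator_pow_valence (hm : 2 ≤ m) (hn : 2 ≤ n) (b : Bool) :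
    generator hm hn b ^ valence m n b = translation 1 := by
  have h1 : (m : ℝ) ≠ 0 := by positivity
  have h2 : (n : ℝ) ≠ 0 := by positivity
  cases b
  · have e : translation (1 / n) ^ n = translation 1 := by
      ext t; rw [translation_pow_apply, translation_apply]; field_simp
    simp only [valence, Bool.false_eq_true, if_false]
    rw [generator_false_pow, e, mul_inv_eq_iff_eq_mul]
    ext t
    exact (bendIso hm hn).2 t
  · ext t
    simp only [generator, valence, if_true]
    rw [translation_pow_apply, translation_apply]; field_simp

theorem generator_true_pow_apply (hm : 2 ≤ m) (hn : 2 ≤ n) (l : ℕ) (t : ℝ) :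
    (generator hm hn true ^ l).1 t = t + l / m := by
  simp only [generator, if_true]
  rw [translation_pow_apply]; ring

/-- The inverse of `bend` takes `(0, m/(m+1))` linearly to `(0, 1/n)`, translation by `l/n` carries
this into `[1/n, 1)`, and there `bend` is given by its other branch. The slope `1/(m(n-1))` is the
quotient of the two slopes of `bend`. -/
theorem generator_false_pow_apply (hm : 2 ≤ m) (hn : 2 ≤ n) {l : ℕ} (hl : 0 < l) (hl' : l < n)
    {t : ℝ} (ht : 0 < t) (ht' : t < m / (m + 1)) :
    (generator hm hn false ^ l).1 t =
      m / (m + 1) + (l - 1) / ((m + 1) * (n - 1)) + 1 / (m * (n - 1)) * t := by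
  have h1 : (2 : ℝ) ≤ m := by exact_mod_cast hm
  have h2 : (2 : ℝ) ≤ n := by exact_mod_cast hn
  have h3 : (0 : ℝ) < n - 1 := by linarith
  have h4 : (1 : ℝ) ≤ l := by exact_mod_cast hl
  have h5 : (l : ℝ) + 1 ≤ n := by exact_mod_cast hl'
  set s : ℝ := t / (n * m / (m + 1)) with hs
  have hst : n * m / (m + 1) * s = t := by rw [hs]; field_simp
  have hs0 : 0 < s := by positivity
  have hs1 : s < 1 / n := by
    rw [hs, div_lt_iff₀ (by positivity)]
    refine ht'.trans_eq ?_
    rw [one_div, mul_div_assoc, inv_mul_cancel_left₀ (by positivity)]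
  have hn1 : (1 : ℝ) / n ≤ 1 / 2 := by gcongr
  have hbs : (bendIso hm hn).1 s = t := by
    rw [bendIso_apply hm hn ⟨hs0.le, by linarith⟩, bend, min_eq_left, hst]
    rw [hst]
    -- The difference of the two branches is factored through the break point, where they agree; the
    -- signs of the factors identify the minimum.
    have e : 1 - n / ((n - 1) * (m + 1)) * (1 - s) - t =
        (1 - n / ((n - 1) * (m + 1))) * (1 - t * ((m + 1) / m)) := by
      rw [hs]; field_simp; ring
    have e1 : 0 ≤ 1 - (n : ℝ) / ((n - 1) * (m + 1)) := by
      rw [sub_nonneg, div_le_one (by positivity)]; nlinarith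
    have e2 : 0 ≤ 1 - t * ((m + 1) / m) := by
      rw [sub_nonneg, ← le_div_iff₀ (by positivity)]
      rw [one_div_div]
      exact ht'.le
    have := mul_nonneg e1 e2
    linarith
  have hbs' : (bendIso hm hn)⁻¹.1 t = s := by
    change (bendIso hm hn).1.symm t = s
    rw [OrderIso.symm_apply_eq, hbs]
  rw [generator_false_pow]
  change (bendIso hm hn).1 ((translation (1 / n) ^ l).1 ((bendIso hm hn)⁻¹.1 t)) = _
  have hl1 : 1 / n ≤ (l : ℝ) * (1 / n) := le_mul_of_one_le_left (by positivity) h4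
  have hl2 : (l : ℝ) * (1 / n) + 1 / n ≤ 1 := by
    have : (l : ℝ) * (1 / n) + 1 / n = (l + 1) / n := by ring
    rw [this, div_le_one (by positivity)]; exact h5
  rw [hbs', translation_pow_apply, bendIso_apply hm hn ⟨by linarith, by linarith⟩, bend,
    min_eq_right]
  · rw [← hst]; field_simp; ring
  · have e : n * m / (m + 1) * (s + l * (1 / n)) -
        (1 - n / ((n - 1) * (m + 1)) * (1 - (s + l * (1 / n)))) =
        (n * m / (m + 1) - n / ((n - 1) * (m + 1))) * (s + (l - 1) * (1 / n)) := by
      field_simp; ring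
    have e1 : 0 ≤ (n * m / (m + 1) - n / ((n - 1) * (m + 1)) : ℝ) := by
      rw [sub_nonneg, div_le_div_iff₀ (by positivity) (by positivity)]
      have : (1 : ℝ) ≤ m * (n - 1) := by nlinarith
      have h6 : (0 : ℝ) ≤ n * (m + 1) := by positivity
      nlinarith
    have := mul_nonneg e1 (show 0 ≤ s + (l - 1) * (1 / n) by
      have : (0 : ℝ) ≤ (l - 1) * (1 / n) := mul_nonneg (by linarith) (by positivity)
      linarith)
    linarith

end Generators

/-! ### The real number with a given sequence of labels -/

section Value

/-- The constant term of the affine map `y ^ l` (for `false`) or `t ↦ x ^ l t - 1` (for `true`). -/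
noncomputable def offset (m n : ℕ) (b : Bool) (l : ℕ) : ℝ :=
  if b then l / m - 1 else m / (m + 1) + (l - 1) / ((m + 1) * (n - 1))

/-- The slope of the affine map `y ^ l` or `x ^ l`. -/
noncomputable def ratio (m n : ℕ) (b : Bool) : ℝ := if b then 1 else 1 / (m * (n - 1))

/-- The product of the first `k` slopes. -/
noncomputable def weight (m n : ℕ) : Bool → ℕ → ℝ
  | _, 0 => 1
  | b, k + 1 => ratio m n b * weight m n (!b) k

/-- The real number with label sequence `l` and sign `b`. -/
noncomputable def value (m n : ℕ) (b : Bool) (l : ℕ → ℕ) : ℝ :=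
  ∑' k, weight m n b k * offset m n (xor b k.bodd) (l k)

/-- The admissible sequences of labels. -/
def admissible (m n : ℕ) (b : Bool) : Set (ℕ → ℕ) :=
  {l | ∀ k, 0 < l k ∧ l k < valence m n (xor b k.bodd)}

variable {m n : ℕ}

theorem two_le_valence (hm : 2 ≤ m) (hn : 2 ≤ n) (b : Bool) : 2 ≤ valence m n b := by
  cases b
  exacts [hn, hm]

theorem tail_mem_admissible {b : Bool} {l : ℕ → ℕ} (hl : l ∈ admissible m n b) :
    (fun k => l (k + 1)) ∈ admissible m n (!b) := by
  intro k
  have := hl (k + 1)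
  rwa [Nat.bodd_succ, Bool.xor_not, ← Bool.not_xor] at this

theorem weight_nonneg (hn : 2 ≤ n) (b : Bool) (k : ℕ) : 0 ≤ weight m n b k := by
  have h2 : (2 : ℝ) ≤ n := by exact_mod_cast hn
  have h3 : (0 : ℝ) < n - 1 := by linarith
  induction k generalizing b with
  | zero => simp [weight]
  | succ k ih =>
    rw [weight]
    refine mul_nonneg ?_ (ih _)
    cases b
    · simp only [ratio, Bool.false_eq_true, if_false]; positivity
    · simp [ratio]

theorem weight_add_two_le (hm : 2 ≤ m) (hn : 2 ≤ n) (b : Bool) (k : ℕ) :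
    weight m n b (k + 2) ≤ 1 / 2 * weight m n b k := by
  have h1 : (2 : ℝ) ≤ m := by exact_mod_cast hm
  have h2 : (2 : ℝ) ≤ n := by exact_mod_cast hn
  have h3 : (1 / (m * (n - 1)) : ℝ) ≤ 1 / 2 := by
    apply one_div_le_one_div_of_le two_pos
    nlinarith
  have h4 := mul_le_mul_of_nonneg_right h3 (weight_nonneg (m := m) hn b k)
  rw [weight, weight, Bool.not_not]
  cases b <;> simpa [ratio] using h4

/-- Two steps contract by at least `1/2`, which is less than `(3/4)²`; the factor `2` gives room for
the starting values. -/
theorem weight_le (hm : 2 ≤ m) (hn : 2 ≤ n) (b : Bool) (k : ℕ) :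
    weight m n b k ≤ 2 * (3 / 4) ^ k := by
  have h1 : (2 : ℝ) ≤ m := by exact_mod_cast hm
  have h2 : (2 : ℝ) ≤ n := by exact_mod_cast hn
  induction k using Nat.twoStepInduction with
  | zero => norm_num [weight]
  | one =>
    have h3 : (1 / (m * (n - 1)) : ℝ) ≤ 1 := by
      rw [div_le_one (by nlinarith)]
      nlinarith
    rw [weight, weight]
    cases b
    · simp only [ratio, Bool.false_eq_true, if_false]; linarith
    · norm_num [ratio]
  | more k ih _ =>
    have := weight_add_two_le hm hn b k
    have h3 : (0 : ℝ) < (3 / 4) ^ k := by positivity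
    rw [pow_add]
    linarith

theorem offset_mono (hn : 2 ≤ n) (b : Bool) {l l' : ℕ} (h : l ≤ l') :
    offset m n b l ≤ offset m n b l' := by
  have h2 : (2 : ℝ) ≤ n := by exact_mod_cast hn
  have h3 : (0 : ℝ) < n - 1 := by linarith
  have h4 : (l : ℝ) ≤ l' := by exact_mod_cast h
  cases b <;> simp only [offset, Bool.false_eq_true, if_false, if_true] <;> gcongr

theorem abs_offset_le (hm : 2 ≤ m) (hn : 2 ≤ n) (b : Bool) {l : ℕ} (hl : 0 < l)
    (hl' : l < valence m n b) : |offset m n b l| ≤ 1 := by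
  have h1 : (2 : ℝ) ≤ m := by exact_mod_cast hm
  have h2 : (2 : ℝ) ≤ n := by exact_mod_cast hn
  have h3 : (0 : ℝ) < n - 1 := by linarith
  have h4 : (1 : ℝ) ≤ l := by exact_mod_cast hl
  cases b
  · have h5 : (l : ℝ) + 1 ≤ n := by exact_mod_cast hl'
    simp only [offset, Bool.false_eq_true, if_false]
    have e1 : ((l - 1) / ((m + 1) * (n - 1)) : ℝ) ≤ 1 / (m + 1) := by
      rw [div_le_div_iff₀ (by positivity) (by positivity)]
      nlinarith
    have e2 : (0 : ℝ) ≤ (l - 1) / ((m + 1) * (n - 1)) := div_nonneg (by linarith) (by positivity)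
    have e3 : (m / (m + 1) : ℝ) = 1 - 1 / (m + 1) := by field_simp; ring
    have e4 : (0 : ℝ) ≤ m / (m + 1) := by positivity
    rw [abs_le]
    constructor <;> linarith
  · have h5 : (l : ℝ) ≤ m := by exact_mod_cast hl'.le
    simp only [offset, if_true]
    have e1 : (l / m : ℝ) ≤ 1 := by rwa [div_le_one (by positivity)]
    have e2 : (0 : ℝ) ≤ l / m := by positivity
    rw [abs_le]
    constructor <;> linarith

theorem norm_term_le (hm : 2 ≤ m) (hn : 2 ≤ n) (b : Bool) {l : ℕ → ℕ} (hl : l ∈ admissible m n b)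
    (k : ℕ) : ‖weight m n b k * offset m n (xor b k.bodd) (l k)‖ ≤ 2 * (3 / 4) ^ k := by
  rw [norm_mul, Real.norm_eq_abs, Real.norm_eq_abs, abs_of_nonneg (weight_nonneg hn b k)]
  exact (mul_le_of_le_one_right (weight_nonneg hn b k)
    (abs_offset_le hm hn _ (hl k).1 (hl k).2)).trans (weight_le hm hn b k)

theorem summable_bound : Summable fun k : ℕ => 2 * (3 / 4 : ℝ) ^ k :=
  (summable_geometric_of_lt_one (by norm_num) (by norm_num)).mul_left 2

theorem summable_term (hm : 2 ≤ m) (hn : 2 ≤ n) (b : Bool) {l : ℕ → ℕ}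
    (hl : l ∈ admissible m n b) :
    Summable fun k => weight m n b k * offset m n (xor b k.bodd) (l k) :=
  Summable.of_norm_bounded summable_bound (norm_term_le hm hn b hl)

theorem value_eq (hm : 2 ≤ m) (hn : 2 ≤ n) (b : Bool) {l : ℕ → ℕ} (hl : l ∈ admissible m n b) :
    value m n b l = offset m n b (l 0) + ratio m n b * value m n (!b) fun k => l (k + 1) := by
  rw [value, (summable_term hm hn b hl).tsum_eq_zero_add, value, ← tsum_mul_left]
  congr 1
  · simp [weight]
  · refine tsum_congr fun k => ?_
    rw [weight, Nat.bodd_succ, Bool.xor_not, ← Bool.not_xor, mul_assoc]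

theorem value_mono (hm : 2 ≤ m) (hn : 2 ≤ n) (b : Bool) {l l' : ℕ → ℕ} (hl : l ∈ admissible m n b)
    (hl' : l' ∈ admissible m n b) (h : l ≤ l') : value m n b l ≤ value m n b l' :=
  (summable_term hm hn b hl).tsum_le_tsum
    (fun k => mul_le_mul_of_nonneg_left (offset_mono hn _ (h k)) (weight_nonneg hn b k))
    (summable_term hm hn b hl')

/-- By monotonicity only the least and the greatest label sequences matter. For these, applying
`value_eq` twice gives a fixed-point equation of slope `1/λ`, where `λ = m(n-1) > 1`. Both extreme
values lie inside the interval, at distance `1/(m(m+1)(λ-1))` from its end. -/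
theorem value_false_bounds (hm : 2 ≤ m) (hn : 2 ≤ n) {l : ℕ → ℕ} (hl : l ∈ admissible m n false) :
    m / (m + 1) < value m n false l ∧ value m n false l < 1 := by
  have h1 : (2 : ℝ) ≤ m := by exact_mod_cast hm
  have h2 : (2 : ℝ) ≤ n := by exact_mod_cast hn
  have h3 : (0 : ℝ) < n - 1 := by linarith
  have hlam : (1 : ℝ) < m * (n - 1) := by nlinarith
  constructor
  · have hlo : ∀ b, (fun _ => 1) ∈ admissible m n b := fun b k =>
      ⟨one_pos, two_le_valence hm hn _⟩
    refine lt_of_lt_of_le ?_ (value_mono hm hn false (hlo _) hl fun k => (hl k).1)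
    have e1 := value_eq hm hn false (hlo false)
    have e2 := value_eq hm hn true (hlo true)
    simp only [offset, ratio, Bool.not_false, Bool.not_true, Bool.false_eq_true, if_false,
      if_true, Nat.cast_one, sub_self, zero_div, add_zero, one_mul] at e1 e2
    rw [e2] at e1
    set v := value m n false fun _ => 1
    have e3 : (m * (n - 1) - 1 : ℝ) * (v - m / (m + 1)) = m / (m + 1) - 1 + 1 / m := by
      have : m * (n - 1) * v = m * (n - 1) * (m / (m + 1)) + (1 / m - 1 + v) := by
        conv_lhs => rw [e1]
        field_simp
      linear_combination this
    have e4 : (0 : ℝ) < m / (m + 1) - 1 + 1 / m := by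
      have : (m / (m + 1) - 1 + 1 / m : ℝ) = 1 / (m * (m + 1)) := by field_simp; ring
      rw [this]; positivity
    have := (mul_pos_iff_of_pos_left (sub_pos.2 hlam)).1 (e3 ▸ e4)
    linarith
  · have hhi : ∀ b, (fun k => valence m n (xor b k.bodd) - 1) ∈ admissible m n b := fun b k => by
      have := two_le_valence hm hn (xor b k.bodd)
      exact ⟨Nat.sub_pos_of_lt this, Nat.sub_lt (by omega) one_pos⟩
    refine lt_of_le_of_lt (value_mono hm hn false hl (hhi _) fun k => by
      have := (hl k).2
      change l k ≤ valence m n (xor false k.bodd) - 1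
      omega) ?_
    have e1 := value_eq hm hn false (hhi false)
    have e2 := value_eq hm hn true (hhi true)
    simp only [Nat.bodd_succ, Bool.xor_not, ← Bool.not_xor, Bool.not_false, Bool.not_true] at e1 e2
    simp only [offset, ratio, Bool.false_eq_true, if_false, if_true, Nat.bodd_zero,
      Bool.xor_false, valence, one_mul] at e1 e2
    rw [e2] at e1
    rw [Nat.cast_sub (by omega), Nat.cast_sub (by omega)] at e1
    simp only [valence]
    set u := value m n false fun k => (if (xor false k.bodd) = true then m else n) - 1
    have e3 : (m * (n - 1) - 1 : ℝ) * (1 - u) = m / (m + 1) + 1 / m - 1 := by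
      have : m * (n - 1) * u = m * (n - 1) * (m / (m + 1)) + m / (m + 1) * (n - 2)
          + ((m - 1) / m - 1 + u) := by
        conv_lhs => rw [e1]
        field_simp
        push_cast
        ring
      have e5 : (m * (n - 1) * (m / (m + 1)) + m / (m + 1) * (n - 2) : ℝ) =
        m * (n - 1) - m / (m + 1) := by field_simp; ring
      have e6 : ((m - 1) / m : ℝ) = 1 - 1 / m := by field_simp
      rw [e5, e6] at this
      linear_combination -this
    have e4 : (0 : ℝ) < m / (m + 1) + 1 / m - 1 := by
      have : (m / (m + 1) + 1 / m - 1 : ℝ) = 1 / (m * (m + 1)) := by field_simp; ring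
      rw [this]; positivity
    have := (mul_pos_iff_of_pos_left (sub_pos.2 hlam)).1 (e3 ▸ e4)
    linarith

theorem value_true_bounds (hm : 2 ≤ m) (hn : 2 ≤ n) {l : ℕ → ℕ} (hl : l ∈ admissible m n true) :
    0 < value m n true l ∧ value m n true l < m / (m + 1) := by
  have h1 : (2 : ℝ) ≤ m := by exact_mod_cast hm
  have h := value_false_bounds hm hn (tail_mem_admissible hl)
  rw [value_eq hm hn true hl]
  simp only [offset, ratio, if_true, one_mul, Bool.not_true]
  have h4 : (1 : ℝ) ≤ l 0 := by exact_mod_cast (hl 0).1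
  have h5 : (l 0 : ℝ) + 1 ≤ m := by exact_mod_cast (hl 0).2
  have e1 : (1 / m : ℝ) ≤ l 0 / m := by gcongr
  have e2 : (l 0 / m + 1 / m : ℝ) ≤ 1 := by
    rw [← add_div, div_le_one (by positivity)]; exact h5
  have e3 : (m / (m + 1) : ℝ) = 1 - 1 / (m + 1) := by field_simp; ring
  have e4 : (1 / (m + 1) : ℝ) < 1 / m := by gcongr; linarith
  constructor <;> linarith

theorem value_mem_Ioo (hm : 2 ≤ m) (hn : 2 ≤ n) {b : Bool} {l : ℕ → ℕ}
    (hl : l ∈ admissible m n b) : value m n b l ∈ Set.Ioo (0 : ℝ) 1 := by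
  have h1 : (m / (m + 1) : ℝ) < 1 := by rw [div_lt_one (by positivity)]; linarith
  have h0 : (0 : ℝ) < m / (m + 1) := by positivity
  cases b
  · have := value_false_bounds hm hn hl
    exact ⟨by linarith, by linarith⟩
  · have := value_true_bounds hm hn hl
    exact ⟨by linarith, by linarith⟩

/-- Raising the first label shifts the value by at least `1/((m+1)(n-1))` for `y`, or `1/m` for `x`;
by the bounds on tails, the tails contribute a smaller difference. Thus images under different
powers do not overlap and appear in the order of the labels. -/
theorem head_lt_head (hm : 2 ≤ m) (hn : 2 ≤ n) {b : Bool} {l l' : ℕ → ℕ}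
    (hl : l ∈ admissible m n b) (hl' : l' ∈ admissible m n b) (h : l 0 < l' 0) :
    value m n b l < value m n b l' := by
  have h1 : (2 : ℝ) ≤ m := by exact_mod_cast hm
  have h2 : (2 : ℝ) ≤ n := by exact_mod_cast hn
  have h3 : (0 : ℝ) < n - 1 := by linarith
  have h4 : (l 0 : ℝ) + 1 ≤ l' 0 := by exact_mod_cast h
  have e3 : (m / (m + 1) : ℝ) = 1 - 1 / (m + 1) := by field_simp; ring
  have e4 : (1 / (m + 1) : ℝ) < 1 / m := by gcongr; linarith
  rw [value_eq hm hn b hl, value_eq hm hn b hl']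
  cases b
  · have a := value_true_bounds hm hn (tail_mem_admissible hl)
    have a' := value_true_bounds hm hn (tail_mem_admissible hl')
    simp only [offset, ratio, Bool.false_eq_true, if_false, Bool.not_false]
    set v := value m n true fun k => l (k + 1)
    set v' := value m n true fun k => l' (k + 1)
    have e5 : (l 0 - 1) / ((m + 1) * (n - 1)) + 1 / ((m + 1) * (n - 1)) ≤
        ((l' 0 - 1) / ((m + 1) * (n - 1)) : ℝ) := by
      rw [← add_div]; gcongr; linarith
    have e6 : 1 / (m * (n - 1)) * (v - v') < 1 / ((m + 1) * (n - 1)) := by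
      calc 1 / (m * (n - 1)) * (v - v') < 1 / (m * (n - 1)) * (m / (m + 1)) := by
            gcongr; linarith
        _ = 1 / ((m + 1) * (n - 1)) := by field_simp
    linarith
  · have a := value_false_bounds hm hn (tail_mem_admissible hl)
    have a' := value_false_bounds hm hn (tail_mem_admissible hl')
    simp only [offset, ratio, if_true, Bool.not_true]
    have e5 : (l 0 / m + 1 / m : ℝ) ≤ l' 0 / m := by rw [← add_div]; gcongr
    linarith

theorem value_injective (hm : 2 ≤ m) (hn : 2 ≤ n) {b b' : Bool} {l l' : ℕ → ℕ}
    (hl : l ∈ admissible m n b) (hl' : l' ∈ admissible m n b')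
    (h : value m n b l = value m n b' l') : b = b' ∧ l = l' := by
  have hb : b = b' := by
    cases b <;> cases b'
    · rfl
    · have := value_false_bounds hm hn hl
      have := value_true_bounds hm hn hl'
      linarith
    · have := value_true_bounds hm hn hl
      have := value_false_bounds hm hn hl'
      linarith
    · rfl
  subst hb
  refine ⟨rfl, funext fun k => ?_⟩
  induction k generalizing b l l' with
  | zero =>
    rcases lt_trichotomy (l 0) (l' 0) with h0 | h0 | h0
    · exact absurd h (head_lt_head hm hn hl hl' h0).ne
    · exact h0
    · exact absurd h (head_lt_head hm hn hl' hl h0).ne'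
  | succ k ih =>
    have h0 : l 0 = l' 0 := by
      rcases lt_trichotomy (l 0) (l' 0) with h0 | h0 | h0
      · exact absurd h (head_lt_head hm hn hl hl' h0).ne
      · exact h0
      · exact absurd h (head_lt_head hm hn hl' hl h0).ne'
    rw [value_eq hm hn b hl, value_eq hm hn b hl', h0, add_right_inj] at h
    have hr : ratio m n b ≠ 0 := by
      have h1 : (2 : ℝ) ≤ m := by exact_mod_cast hm
      have h2 : (2 : ℝ) ≤ n := by exact_mod_cast hn
      have h3 : (0 : ℝ) < n - 1 := by linarith
      cases b <;> simp only [ratio, Bool.false_eq_true, if_false, if_true] <;> positivity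
    exact ih (tail_mem_admissible hl) (tail_mem_admissible hl') (mul_left_cancel₀ hr h)

/-- Tychonoff for finite alphabets; with `continuousOn_value` it makes the image of the ends closed.
-/
theorem isCompact_admissible (m n : ℕ) (b : Bool) : IsCompact (admissible m n b) := by
  have : admissible m n b = Set.univ.pi fun k => Set.Ioo 0 (valence m n (xor b k.bodd)) := by
    ext l; simp [admissible]
  rw [this]
  exact isCompact_univ_pi fun k => (Set.finite_Ioo _ _).isCompact

theorem continuousOn_value (hm : 2 ≤ m) (hn : 2 ≤ n) (b : Bool) :
    ContinuousOn (value m n b) (admissible m n b) :=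
  continuousOn_tsum
    (fun k => (continuous_const.mul
      ((continuous_of_discreteTopology (f := offset m n (xor b k.bodd))).comp
        (continuous_apply k))).continuousOn)
    summable_bound fun k _ hl => norm_term_le hm hn b hl k

/-- The affine recursion for `value` is the action of the generators. -/
theorem generator_pow_value (hm : 2 ≤ m) (hn : 2 ≤ n) {b : Bool} {l : ℕ → ℕ}
    (hl : l ∈ admissible m n b) :
    circleHom (generator hm hn b ^ l 0) ((value m n (!b) fun k => l (k + 1) : ℝ)) =
      ((value m n b l : ℝ) : AddCircle (1 : ℝ)) := by
  rw [circleHom_coe, value_eq hm hn b hl]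
  cases b
  · have h := value_true_bounds hm hn (tail_mem_admissible hl)
    rw [Bool.not_false, generator_false_pow_apply hm hn (hl 0).1 (hl 0).2 h.1 h.2]
    simp only [offset, ratio, Bool.false_eq_true, if_false]
  · rw [generator_true_pow_apply]
    simp only [offset, ratio, if_true, one_mul]
    rw [← AddCircle.coe_add_period (1 : ℝ) ((l 0 / m : ℝ) - 1 + _)]
    congr 1
    ring

end Value

variable {m n : ℕ}

/-! ### Edges and vertices of the tree -/

section Tree

theorem vert_type_eq {b b' : Bool} {g g' : Zmn m n} (h : vert b g = vert b' g') : b = b' := by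
  cases b <;> cases b' <;> simp [vert] at h ⊢

theorem vert_eq_iff {b : Bool} {g g' : Zmn m n} :
    vert b g = vert b g' ↔ g⁻¹ * g' ∈ Subgroup.zpowers (letter m n b) := by
  cases b
  · simp [vert, letter, QuotientGroup.eq]
  · simp [vert, letter, QuotientGroup.eq]

/-- An edge is determined by its end points because `⟨X⟩ ∩ ⟨Y⟩` is trivial, as the projection to the
first factor shows. -/
theorem edge_eq_of_vert_eq {b : Bool} {g g' : Zmn m n} (h : vert b g = vert b g')
    (h' : vert (!b) g = vert (!b) g') : g = g' := by
  have key : ∀ {z : Zmn m n}, z ∈ Subgroup.zpowers (X m n) → z ∈ Subgroup.zpowers (Y m n) →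
      z = 1 := by
    rintro _ ⟨i, rfl⟩ ⟨j, hj⟩
    have h1 := congrArg (Monoid.Coprod.fst (N := Multiplicative (ZMod n))) hj
    simp only [X, Y, map_zpow, Monoid.Coprod.fst_apply_inl, Monoid.Coprod.fst_apply_inr,
      one_zpow] at h1
    change X m n ^ i = 1
    rw [X, ← map_zpow, ← h1, map_one]
  rw [vert_eq_iff] at h h'
  rw [← inv_mul_eq_one]
  cases b
  · exact key h' h
  · exact key h h'

theorem letter_pow_valence (b : Bool) : letter m n b ^ valence m n b = 1 := by
  cases b
  · exact Y_pow m n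
  · exact X_pow m n

theorem letter_pow_injective {b : Bool} {l l' : ℕ} (hl : l < valence m n b)
    (hl' : l' < valence m n b) (h : letter m n b ^ l = letter m n b ^ l') : l = l' := by
  have key : ∀ {l l' : ℕ}, l' < valence m n b → letter m n b ^ l = letter m n b ^ l' →
      ¬ l < l' := by
    intro l l' hl' h hlt
    refine Code.vert_ne b (1 : Zmn m n) (l := l' - l) (by omega) (by omega) ?_
    rw [show l' = l + (l' - l) by omega, pow_add, left_eq_mul] at h
    rw [h, mul_one]
  have h1 := key hl' h
  have h2 := key hl h.symm
  omega

theorem exists_pow_eq_of_mem_zpowers {b : Bool} (hv : 0 < valence m n b) {z : Zmn m n}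
    (hz : z ∈ Subgroup.zpowers (letter m n b)) : ∃ l < valence m n b, z = letter m n b ^ l := by
  obtain ⟨i, rfl⟩ := hz
  have hv' : (valence m n b : ℤ) ≠ 0 := by omega
  refine ⟨(i % valence m n b).toNat, ?_, ?_⟩
  · have := Int.emod_lt_of_pos i (show (0 : ℤ) < valence m n b by omega)
    omega
  · rw [← zpow_natCast, Int.toNat_of_nonneg (Int.emod_nonneg i hv')]
    conv_lhs => rw [← Int.emod_add_mul_ediv i (valence m n b)]
    beta_reduce
    rw [zpow_add, zpow_mul, zpow_natCast, letter_pow_valence, one_zpow, mul_one]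

/-- Inverses need no case, the letters being of finite order. -/
theorem zmn_induction (hm : 2 ≤ m) (hn : 2 ≤ n) {p : Zmn m n → Prop} (h1 : p 1)
    (hmul : ∀ g h, p g → p h → p (g * h)) (hlet : ∀ b, p (letter m n b)) (g : Zmn m n) : p g := by
  have hpow : ∀ b (k : ℕ), p (letter m n b ^ k) := by
    intro b k
    induction k with
    | zero => simpa using h1
    | succ k ih => rw [pow_succ]; exact hmul _ _ ih (hlet b)
  have : NeZero m := ⟨by omega⟩
  have : NeZero n := ⟨by omega⟩
  induction g using Monoid.Coprod.induction_on with
  | inl z =>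
    convert hpow true (ZMod.val z.toAdd) using 1
    simp only [letter, if_true, X]
    rw [← map_pow, ← ofAdd_nsmul, nsmul_one, ZMod.natCast_zmod_val, ofAdd_toAdd]
  | inr z =>
    convert hpow false (ZMod.val z.toAdd) using 1
    simp only [letter, Bool.false_eq_true, if_false, Y]
    rw [← map_pow, ← ofAdd_nsmul, nsmul_one, ZMod.natCast_zmod_val, ofAdd_toAdd]
  | mul g h hg hh => exact hmul g h hg hh

theorem Ends.smul_mul (g h : Zmn m n) (e : Ends m n) :
    Ends.smul (g * h) e = Ends.smul g (Ends.smul h e) := by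
  induction e using Quotient.inductionOn with
  | h r => exact Quotient.sound ⟨0, 0, fun k => mul_smul _ _ _⟩

theorem Ends.smul_one (e : Ends m n) : Ends.smul 1 e = e := by
  induction e using Quotient.inductionOn with
  | h r => exact Quotient.sound ⟨0, 0, fun k => one_smul _ _⟩

end Tree

/-! ### Codes and rays -/

namespace Code

theorem label_mem_admissible (c : Code m n) : c.label ∈ admissible m n c.sign :=
  fun k => ⟨c.pos k, c.lt k⟩

/-- The code with a given admissible sequence of labels. -/
def ofAdmissible {b : Bool} {l : ℕ → ℕ} (hl : l ∈ admissible m n b) : Code m n where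
  sign := b
  label := l
  pos k := (hl k).1
  lt k := (hl k).2

theorem ext_of_eq {c d : Code m n} (hs : c.sign = d.sign) (hl : c.label = d.label) : c = d := by
  obtain ⟨s, l, _, _⟩ := c
  obtain ⟨s', l', _, _⟩ := d
  subst hs hl
  rfl

/-- The code without its first label. -/
def tail (c : Code m n) : Code m n := ofAdmissible (tail_mem_admissible c.label_mem_admissible)

/-- The code with an additional first label. -/
def cons (c : Code m n) (l : ℕ) (hl : 0 < l) (hl' : l < valence m n (!c.sign)) : Code m n where
  sign := !c.sign
  label k := Nat.casesOn k l c.label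
  pos k := by
    cases k
    exacts [hl, c.pos _]
  lt k := by
    cases k with
    | zero => simpa using hl'
    | succ k => simpa [Nat.bodd_succ] using c.lt k

theorem tail_cons (c : Code m n) (l : ℕ) (hl : 0 < l) (hl' : l < valence m n (!c.sign)) :
    (c.cons l hl hl').tail = c :=
  ext_of_eq (by simp [tail, ofAdmissible, cons]) rfl

theorem side_tail (c : Code m n) (k : ℕ) : c.tail.side k = c.side (k + 1) := by
  rw [side_succ]; simp [side, tail, ofAdmissible]

theorem edge_tail (c : Code m n) (k : ℕ) :
    letter m n c.sign ^ c.label 0 * c.tail.edge k = c.edge (k + 1) := by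
  induction k with
  | zero => simp [edge, side]
  | succ k ih => rw [edge, ← mul_assoc, ih, edge, side_tail]; rfl

theorem ray_tail (c : Code m n) (k : ℕ) :
    c.ray.toFun (k + 1) = (letter m n c.sign ^ c.label 0) • c.tail.ray.toFun k := by
  change vert _ _ = _ • vert _ _
  rw [smul_vert, edge_tail, side_tail]

/-- Deleting the first step of a ray keeps its end. This is the counterpart on ends of the recursion
`generator_pow_value`. -/
theorem toEnd_eq (c : Code m n) :
    c.toEnd = Ends.smul (letter m n c.sign ^ c.label 0) c.tail.toEnd :=
  Quotient.sound ⟨1, 0, fun k => by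
    rw [zero_add, add_comm]; exact c.ray_tail k⟩

/-- Consecutive vertices determine the edges, and successive edges determine the labels, which are
less than the valence. -/
theorem eq_of_smul_ray_eq {g g' : Zmn m n} {c c' : Code m n}
    (h : ∀ k, g • c.ray.toFun k = g' • c'.ray.toFun k) : g = g' ∧ c = c' := by
  have hray : ∀ (g : Zmn m n) (c : Code m n) k,
      g • c.ray.toFun k = vert (!c.side k) (g * c.edge k) := fun g c k => smul_vert _ _ _
  have hray' : ∀ (g : Zmn m n) (c : Code m n) k,
      g • c.ray.toFun (k + 1) = vert (!!c.side k) (g * c.edge k) := by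
    intro g c k
    rw [hray, side_succ, edge, ← mul_assoc, Bool.not_not, vert_mul_pow]
  have hs : ∀ k, c.side k = c'.side k := by
    intro k
    have := h k
    rw [hray, hray] at this
    simpa using vert_type_eq this
  have he : ∀ k, g * c.edge k = g' * c'.edge k := by
    intro k
    have h1 := h k
    have h2 := h (k + 1)
    rw [hray, hray, hs] at h1
    rw [hray', hray', hs] at h2
    exact edge_eq_of_vert_eq h1 h2
  obtain rfl : g = g' := by simpa [edge] using he 0
  refine ⟨rfl, ext_of_eq (by simpa [side] using hs 0) (funext fun k => ?_)⟩
  have h1 := mul_left_cancel (he k)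
  have h2 := mul_left_cancel (he (k + 1))
  rw [edge, edge, h1, hs] at h2
  have hlt := c.lt k
  change c.label k < valence m n (c.side k) at hlt
  rw [hs] at hlt
  exact letter_pow_injective hlt (c'.lt k) (mul_left_cancel h2)

/-- Every ray is the translate of the ray of a code. -/
theorem exists_smul_ray_eq (hm : 2 ≤ m) (hn : 2 ≤ n) (r : Ray m n) {b : Bool} {g : Zmn m n}
    (h0 : r.toFun 0 = vert b g) (h1 : r.toFun 1 = vert (!b) g) :
    ∃ c : Code m n, c.sign = !b ∧ ∀ k, r.toFun k = g • c.ray.toFun k := by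
  have step : ∀ (k : ℕ) (h : Zmn m n), ∃ l, r.toFun k = vert (xor b k.bodd) h →
      r.toFun (k + 1) = vert (!xor b k.bodd) h →
      0 < l ∧ l < valence m n (!xor b k.bodd) ∧
        r.toFun (k + 2) = vert (xor b k.bodd) (h * letter m n (!xor b k.bodd) ^ l) := by
    intro k h
    by_cases hk : r.toFun k = vert (xor b k.bodd) h ∧ r.toFun (k + 1) = vert (!xor b k.bodd) h
    swap
    -- A dummy label: the statement is made for every `h` so that `choose` gives a function that can
    -- be iterated.
    · exact ⟨0, fun h1 h2 => absurd ⟨h1, h2⟩ hk⟩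
    obtain ⟨e1, e2⟩ := hk
    generalize xor b k.bodd = s at *
    obtain ⟨h', b', e3, e4⟩ := r.adj (k + 1)
    rw [e2] at e3
    obtain rfl := vert_type_eq e3
    rw [vert_eq_iff] at e3
    obtain ⟨l, hl, e5⟩ := exists_pow_eq_of_mem_zpowers
      (by have := two_le_valence hm hn (!s); omega) e3
    obtain rfl := inv_mul_eq_iff_eq_mul.1 e5
    rw [Bool.not_not] at e4
    refine ⟨l, fun _ _ => ⟨Nat.pos_of_ne_zero ?_, hl, e4⟩⟩
    rintro rfl
    apply r.reduced k
    rw [e1]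
    change r.toFun (k + 1 + 1) = _
    rw [e4, pow_zero, mul_one]
  choose L hL using step
  let e : ℕ → Zmn m n := fun k =>
    Nat.rec g (fun j h => h * letter m n (!xor b j.bodd) ^ L j h) k
  have he : ∀ k, e (k + 1) = e k * letter m n (!xor b k.bodd) ^ L k (e k) := fun k => rfl
  have hr : ∀ k, r.toFun k = vert (xor b k.bodd) (e k) ∧
      r.toFun (k + 1) = vert (!xor b k.bodd) (e k) := by
    intro k
    induction k with
    | zero => simpa using ⟨h0, h1⟩
    | succ k ih =>
      obtain ⟨-, -, h3⟩ := hL k (e k) ih.1 ih.2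
      rw [he, Nat.bodd_succ, Bool.xor_not, vert_mul_pow, Bool.not_not]
      exact ⟨ih.2, h3⟩
  have hadm : (fun k => L k (e k)) ∈ admissible m n (!b) := fun k => by
    obtain ⟨h3, h4, -⟩ := hL k (e k) (hr k).1 (hr k).2
    exact ⟨h3, by simpa using h4⟩
  refine ⟨ofAdmissible hadm, rfl, fun k => ?_⟩
  have hside : ∀ k, (ofAdmissible hadm).side k = !xor b k.bodd := fun k => by
    simp [side, ofAdmissible]
  have hedge : ∀ k, g * (ofAdmissible hadm).edge k = e k := by
    intro k
    induction k with
    | zero => simp [edge, e]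
    | succ k ih => rw [edge, ← mul_assoc, ih, he, hside]; rfl
  rw [(hr k).1]
  change _ = g • vert _ _
  rw [smul_vert, hedge, hside, Bool.not_not]

theorem exists_smul_toEnd_eq (hm : 2 ≤ m) (hn : 2 ≤ n) (e : Ends m n) :
    ∃ (g : Zmn m n) (c : Code m n), Ends.smul g c.toEnd = e := by
  induction e using Quotient.inductionOn with
  | h r =>
    obtain ⟨g, b, h0, h1⟩ := r.adj 0
    obtain ⟨c, -, hc⟩ := exists_smul_ray_eq hm hn r h0 h1
    exact ⟨g, c, Quotient.sound ⟨0, 0, fun k => (hc _).symm⟩⟩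

/-- If the letter has the type of the first vertex, it raises the first label by one, or deletes it
when the label becomes the valence; otherwise it prefixes the label `1`. -/
theorem exists_letter_smul_toEnd_eq (hm : 2 ≤ m) (hn : 2 ≤ n) (b : Bool) (c : Code m n) :
    ∃ d : Code m n, Ends.smul (letter m n b) c.toEnd = d.toEnd := by
  have hcons : ∀ (c : Code m n) (l : ℕ) (hl : 0 < l) (hl' : l < valence m n (!c.sign)),
      (c.cons l hl hl').toEnd = Ends.smul (letter m n (!c.sign) ^ l) c.toEnd := by
    intro c l hl hl'
    rw [toEnd_eq, tail_cons]; rfl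
  by_cases hb : c.sign = b
  · subst hb
    rw [toEnd_eq, ← Ends.smul_mul, ← pow_succ']
    have hs : (!c.tail.sign) = c.sign := by simp [tail, ofAdmissible]
    have hlt := c.lt 0
    rw [Nat.bodd_zero, Bool.xor_false] at hlt
    rcases (Nat.succ_le_of_lt hlt).eq_or_lt with h | h
    · refine ⟨c.tail, ?_⟩
      rw [show c.label 0 + 1 = _ from h, letter_pow_valence, Ends.smul_one]
    · refine ⟨c.tail.cons (c.label 0 + 1) (Nat.succ_pos _) (by rw [hs]; exact h), ?_⟩
      rw [hcons, hs]
  · have hb' : (!c.sign) = b := by cases h : c.sign <;> cases b <;> simp_all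
    subst hb'
    refine ⟨c.cons 1 one_pos (two_le_valence hm hn _), ?_⟩
    rw [hcons, pow_one]

theorem exists_smul_eq_toEnd (hm : 2 ≤ m) (hn : 2 ≤ n) (g : Zmn m n) :
    ∀ c : Code m n, ∃ d : Code m n, Ends.smul g c.toEnd = d.toEnd := by
  induction g using zmn_induction hm hn with
  | h1 => exact fun c => ⟨c, Ends.smul_one _⟩
  | hmul g h hg hh =>
    intro c
    obtain ⟨d, hd⟩ := hh c
    rw [Ends.smul_mul, hd]
    exact hg d
  | hlet b => exact exists_letter_smul_toEnd_eq hm hn b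

theorem toEnd_surjective (hm : 2 ≤ m) (hn : 2 ≤ n) (e : Ends m n) :
    ∃ c : Code m n, c.toEnd = e := by
  obtain ⟨g, c, rfl⟩ := exists_smul_toEnd_eq hm hn e
  obtain ⟨d, hd⟩ := exists_smul_eq_toEnd hm hn g c
  exact ⟨d, hd.symm⟩

/-- The point of the circle with a given code. -/
noncomputable def circlePoint (c : Code m n) : AddCircle (1 : ℝ) := (value m n c.sign c.label : ℝ)

theorem circlePoint_injective (hm : 2 ≤ m) (hn : 2 ≤ n) {c d : Code m n}
    (h : c.circlePoint = d.circlePoint) : c = d := by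
  have hc := value_mem_Ioo hm hn c.label_mem_admissible
  have hd := value_mem_Ioo hm hn d.label_mem_admissible
  have h1 := (AddCircle.equivIco (1 : ℝ) 0).symm.injective
    (a₁ := ⟨_, hc.1.le, hc.2.trans_eq (zero_add 1).symm⟩)
    (a₂ := ⟨_, hd.1.le, hd.2.trans_eq (zero_add 1).symm⟩) h
  obtain ⟨h2, h3⟩ := value_injective hm hn c.label_mem_admissible d.label_mem_admissible
    (congrArg Subtype.val h1)
  exact ext_of_eq h2 h3

theorem isClosed_range_circlePoint (hm : 2 ≤ m) (hn : 2 ≤ n) :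
    IsClosed (Set.range (circlePoint : Code m n → AddCircle (1 : ℝ))) := by
  have h : Set.range (circlePoint : Code m n → AddCircle (1 : ℝ)) =
      ⋃ b, (fun l => ((value m n b l : ℝ) : AddCircle (1 : ℝ))) '' admissible m n b := by
    ext z
    simp only [Set.mem_range, Set.mem_iUnion, Set.mem_image]
    constructor
    · rintro ⟨c, rfl⟩
      exact ⟨c.sign, c.label, c.label_mem_admissible, rfl⟩
    · rintro ⟨b, l, hl, rfl⟩
      exact ⟨ofAdmissible hl, rfl⟩
  rw [h]
  exact isClosed_iUnion_of_finite fun b => ((isCompact_admissible m n b).image_of_continuousOn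
    ((AddCircle.continuous_mk' (1 : ℝ)).comp_continuousOn (continuousOn_value hm hn b))).isClosed

end Code

/-! ### Existence of a standard action -/

section Existence

/-- The homomorphism from `ℤ_k` with given value at the generator. -/
def zmodHom {H : Type*} [Group H] (k : ℕ) (h : H) (hk : h ^ k = 1) : Multiplicative (ZMod k) →* H :=
  AddMonoidHom.toMultiplicativeLeft
    (ZMod.lift k ⟨zmultiplesHom (Additive H) (Additive.ofMul h), by
      rw [zmultiplesHom_apply, natCast_zsmul, ← ofMul_pow, hk, ofMul_one]⟩)

theorem zmodHom_ofAdd_one {H : Type*} [Group H] (k : ℕ) (h : H) (hk : h ^ k = 1) :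
    zmodHom k h hk (Multiplicative.ofAdd 1) = h := by
  have := ZMod.lift_coe k ⟨zmultiplesHom (Additive H) (Additive.ofMul h), by
      rw [zmultiplesHom_apply, natCast_zsmul, ← ofMul_pow, hk, ofMul_one]⟩ 1
  rw [Int.cast_one] at this
  exact congrArg Additive.toMul (this.trans (one_zsmul _))

theorem circleHom_translation_one : circleHom (translation 1) = 1 := by
  ext z
  induction z using QuotientAddGroup.induction_on with
  | H t => exact AddCircle.coe_add_period 1 t

theorem circleHom_generator_pow_valence (hm : 2 ≤ m) (hn : 2 ≤ n) (b : Bool) :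
    circleHom (generator hm hn b) ^ valence m n b = 1 := by
  rw [← map_pow, generator_pow_valence, circleHom_translation_one]

/-- The action of `Z_{m,n}` on the circle. -/
noncomputable def circleAction (hm : 2 ≤ m) (hn : 2 ≤ n) :
    Zmn m n →* (AddCircle (1 : ℝ) ≃ₜ AddCircle (1 : ℝ)) :=
  Monoid.Coprod.lift (zmodHom m _ (circleHom_generator_pow_valence hm hn true))
    (zmodHom n _ (circleHom_generator_pow_valence hm hn false))

theorem circleAction_letter (hm : 2 ≤ m) (hn : 2 ≤ n) (b : Bool) :
    circleAction hm hn (letter m n b) = circleHom (generator hm hn b) := by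
  cases b
  · simp only [circleAction, letter, Bool.false_eq_true, if_false, Y, Monoid.Coprod.lift_apply_inr]
    exact zmodHom_ofAdd_one _ _ _
  · simp only [circleAction, letter, if_true, X, Monoid.Coprod.lift_apply_inl]
    exact zmodHom_ofAdd_one _ _ _

theorem circleAction_mul_apply (hm : 2 ≤ m) (hn : 2 ≤ n) (g h : Zmn m n) (z : AddCircle (1 : ℝ)) :
    circleAction hm hn (g * h) z = circleAction hm hn g (circleAction hm hn h z) := by
  rw [map_mul]; rfl

theorem sbtw_circleAction (hm : 2 ≤ m) (hn : 2 ≤ n) (g : Zmn m n) :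
    ∀ u v w : AddCircle (1 : ℝ), sbtw u v w →
      sbtw (circleAction hm hn g u) (circleAction hm hn g v) (circleAction hm hn g w) := by
  induction g using zmn_induction hm hn with
  | h1 => intro u v w h; rw [map_one]; exact h
  | hmul g h hg hh =>
    intro u v w huvw
    simp only [circleAction_mul_apply]
    exact hg _ _ _ (hh _ _ _ huvw)
  | hlet b =>
    intro u v w h
    rw [circleAction_letter]
    exact sbtw_circleHom _ h

theorem circleAction_tail (hm : 2 ≤ m) (hn : 2 ≤ n) (c : Code m n) :
    circleAction hm hn (letter m n c.sign ^ c.label 0) c.tail.circlePoint = c.circlePoint := by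
  rw [map_pow, circleAction_letter, ← map_pow]
  exact generator_pow_value hm hn c.label_mem_admissible

/-- Labels are moved one by one from the code into the translating element, which changes neither
the tail of the ray nor the point of the circle. -/
theorem exists_shift (hm : 2 ≤ m) (hn : 2 ≤ n) (a : ℕ) (g : Zmn m n) (c : Code m n) :
    ∃ (h : Zmn m n) (d : Code m n), (∀ k, g • c.ray.toFun (a + k) = h • d.ray.toFun k) ∧
      circleAction hm hn g c.circlePoint = circleAction hm hn h d.circlePoint := by
  induction a generalizing g c with
  | zero => exact ⟨g, c, fun k => by rw [zero_add], rfl⟩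
  | succ a ih =>
    obtain ⟨h, d, h1, h2⟩ := ih (g * letter m n c.sign ^ c.label 0) c.tail
    refine ⟨h, d, fun k => ?_, ?_⟩
    · rw [← h1, mul_smul, ← Code.ray_tail]
      congr 2
      ring
    · rw [← h2, circleAction_mul_apply, circleAction_tail]

/-- Well-definedness and equivariance of the embedding at once: equal ends share a tail, and after
shifting to it both the group elements and the codes coincide. -/
theorem circleAction_eq_of_smul_toEnd_eq (hm : 2 ≤ m) (hn : 2 ≤ n) {g g' : Zmn m n}
    {c c' : Code m n} (h : Ends.smul g c.toEnd = Ends.smul g' c'.toEnd) :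
    circleAction hm hn g c.circlePoint = circleAction hm hn g' c'.circlePoint := by
  obtain ⟨a, a', h⟩ := Quotient.exact h
  obtain ⟨k, d, h1, h2⟩ := exists_shift hm hn a g c
  obtain ⟨k', d', h1', h2'⟩ := exists_shift hm hn a' g' c'
  obtain ⟨rfl, rfl⟩ := Code.eq_of_smul_ray_eq (g := k) (g' := k') (c := d) (c' := d') fun i => by
    rw [← h1, ← h1']; exact h i
  rw [h2, h2']

/-- The embedding of the ends into the circle. -/
noncomputable def endPoint (hm : 2 ≤ m) (hn : 2 ≤ n) (e : Ends m n) : AddCircle (1 : ℝ) :=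
  (Code.toEnd_surjective hm hn e).choose.circlePoint

theorem endPoint_smul_toEnd (hm : 2 ≤ m) (hn : 2 ≤ n) (g : Zmn m n) (c : Code m n) :
    endPoint hm hn (Ends.smul g c.toEnd) = circleAction hm hn g c.circlePoint := by
  have h := (Code.toEnd_surjective hm hn (Ends.smul g c.toEnd)).choose_spec
  rw [← Ends.smul_one (Code.toEnd _)] at h
  have := circleAction_eq_of_smul_toEnd_eq hm hn h
  rw [map_one] at this
  exact this

theorem endPoint_toEnd (hm : 2 ≤ m) (hn : 2 ≤ n) (c : Code m n) :
    endPoint hm hn c.toEnd = c.circlePoint := by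
  rw [← Ends.smul_one c.toEnd, endPoint_smul_toEnd, map_one]; rfl

/-- After translation by `g⁻¹`, the first end lies in the interval of sign `!b`, the other two in
that of sign `b` with first labels `j < k`, so `head_lt_head` orders them. -/
theorem sbtw_endPoint (hm : 2 ≤ m) (hn : 2 ≤ n) {e₁ e₂ e₃ : Ends m n} (h : Ends.Cyc e₁ e₂ e₃) :
    sbtw (endPoint hm hn e₁) (endPoint hm hn e₂) (endPoint hm hn e₃) := by
  obtain ⟨b, g, j, k, r₁, r₂, r₃, hj, hjk, hk, rfl, rfl, rfl, h1, h1', h2, h2', h3, h3'⟩ := h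
  have key : ∀ (r : Ray m n) (l : ℕ), r.toFun 0 = vert b g →
      r.toFun 1 = vert (!b) (g * letter m n b ^ l) → ∃ c : Code m n, c.sign = !b ∧
        endPoint hm hn r.toEnd =
          circleAction hm hn g (circleAction hm hn (letter m n b ^ l) c.circlePoint) := by
    intro r l h h'
    rw [← Code.vert_mul_pow b g l] at h
    obtain ⟨c, hs, hc⟩ := Code.exists_smul_ray_eq hm hn r h h'
    refine ⟨c, hs, ?_⟩
    have : r.toEnd = Ends.smul (g * letter m n b ^ l) c.toEnd :=
      Quotient.sound ⟨0, 0, fun k => hc _⟩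
    rw [this, endPoint_smul_toEnd, circleAction_mul_apply]
  have hcons : ∀ (c : Code m n) (l : ℕ), c.sign = (!b) → 0 < l → l < valence m n b →
      ∃ d : Code m n, d.sign = b ∧ d.label 0 = l ∧
        circleAction hm hn (letter m n b ^ l) c.circlePoint = d.circlePoint := by
    intro c l hs hl hl'
    have hs' : (!c.sign) = b := by rw [hs, Bool.not_not]
    subst hs'
    refine ⟨c.cons l hl hl', rfl, rfl, ?_⟩
    rw [← circleAction_tail hm hn (c.cons l hl hl'), Code.tail_cons]
    rfl
  obtain ⟨c₁, hs₁, e1⟩ := key r₁ 0 h1 (by simpa using h1')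
  obtain ⟨c₂, hs₂, e2⟩ := key r₂ j h2 h2'
  obtain ⟨c₃, hs₃, e3⟩ := key r₃ k h3 h3'
  obtain ⟨d₂, hd₂, hl₂, e2'⟩ := hcons c₂ j hs₂ hj (hjk.trans hk)
  obtain ⟨d₃, hd₃, hl₃, e3'⟩ := hcons c₃ k hs₃ (hj.trans hjk) hk
  rw [e1, e2, e3, e2', e3', pow_zero, map_one]
  refine sbtw_circleAction hm hn g _ _ _ ?_
  change sbtw c₁.circlePoint _ _
  have a1 := c₁.label_mem_admissible
  have a2 := d₂.label_mem_admissible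
  have a3 := d₃.label_mem_admissible
  unfold Code.circlePoint
  rw [hs₁] at a1 ⊢
  rw [hd₂] at a2 ⊢
  rw [hd₃] at a3 ⊢
  have hlt := head_lt_head hm hn a2 a3 (by rw [hl₂, hl₃]; exact hjk)
  have i1 := value_mem_Ioo hm hn a1
  have i2 := value_mem_Ioo hm hn a2
  have i3 := value_mem_Ioo hm hn a3
  cases b
  · have b1 := value_true_bounds hm hn a1
    have b2 := value_false_bounds hm hn a2
    exact sbtw_coe_of_lt (by simpa using b1.2.trans b2.1) hlt (by simpa using by linarith [i3.2, b1.1])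
  · have b1 := value_false_bounds hm hn a1
    have b3 := value_true_bounds hm hn a3
    -- The first point lies in the upper interval, so its lift is lowered by `1` to precede the
    -- others.
    rw [Bool.not_true, ← sub_add_cancel (value m n false c₁.label) 1, AddCircle.coe_add_period]
    exact sbtw_coe_of_lt (by linarith [b1.2, i2.1]) hlt (by linarith [b1.1, b3.2])

/-- The action of `G_{m,n}` by periodic homeomorphisms of the line. -/
noncomputable def lineAction (hm : 2 ≤ m) (hn : 2 ≤ n) : Gmn m n →* periodicIso :=
  PresentedGroup.toGroup (f := ![generator hm hn true, generator hm hn false]) (by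
    have h1 := generator_pow_valence hm hn true
    have h2 := generator_pow_valence hm hn false
    simp only [valence, if_true, Bool.false_eq_true, if_false] at h1 h2
    simp [h1, h2])

theorem lineAction_x (hm : 2 ≤ m) (hn : 2 ≤ n) :
    lineAction hm hn (x m n) = generator hm hn true := by
  simp [lineAction, x]

theorem lineAction_y (hm : 2 ≤ m) (hn : 2 ≤ n) :
    lineAction hm hn (y m n) = generator hm hn false := by
  simp [lineAction, y]

theorem circleHom_lineAction (hm : 2 ≤ m) (hn : 2 ≤ n) (g : Gmn m n) :
    circleHom (lineAction hm hn g) = circleAction hm hn (proj m n g) := by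
  have h : circleHom.comp (lineAction hm hn) = (circleAction hm hn).comp (proj m n) := by
    refine PresentedGroup.ext fun i => ?_
    fin_cases i
    · change circleHom (lineAction hm hn (x m n)) = circleAction hm hn (proj m n (x m n))
      rw [lineAction_x, StandardAction.proj_x, circleAction_letter]
    · change circleHom (lineAction hm hn (y m n)) = circleAction hm hn (proj m n (y m n))
      rw [lineAction_y, StandardAction.proj_y, circleAction_letter]
  exact DFunLike.congr_fun h g

/-- A standard action. -/
noncomputable def standardAction (hm : 2 ≤ m) (hn : 2 ≤ n) : StandardAction m n where
  ι := endPoint hm hn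
  injective e e' h := by
    obtain ⟨c, rfl⟩ := Code.toEnd_surjective hm hn e
    obtain ⟨d, rfl⟩ := Code.toEnd_surjective hm hn e'
    rw [endPoint_toEnd, endPoint_toEnd] at h
    rw [Code.circlePoint_injective hm hn h]
  sbtw_of_cyc _ _ _ h := sbtw_endPoint hm hn h
  isClosed_range := by
    convert Code.isClosed_range_circlePoint (m := m) (n := n) hm hn using 1
    ext z
    constructor
    · rintro ⟨e, rfl⟩
      obtain ⟨c, rfl⟩ := Code.toEnd_surjective hm hn e
      exact ⟨c, (endPoint_toEnd hm hn c).symm⟩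
    · rintro ⟨c, rfl⟩
      exact ⟨c.toEnd, endPoint_toEnd hm hn c⟩
  ρ := circleAction hm hn
  sbtw_map g a b c h := sbtw_circleAction hm hn g a b c h
  extends_ends g e := by
    obtain ⟨c, rfl⟩ := Code.toEnd_surjective hm hn e
    rw [endPoint_toEnd, endPoint_smul_toEnd]
  Θ := periodicIso.subtype.comp (lineAction hm hn)
  lift g t := by
    rw [← circleHom_lineAction]; rfl
  central t := by
    have h := generator_pow_valence hm hn true
    simp only [valence, if_true] at h
    change (lineAction hm hn (x m n ^ m)).1 t = t + 1
    rw [map_pow, lineAction_x, h, translation_apply]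

end Existence

end DehornoyLike

/-! ### The theorem -/

theorem theorem3p2 (m n : ℕ) (hn : 2 ≤ n) (hm : 2 ≤ m) (hmn : n ≤ m) (hne : (m, n) ≠ (2, 2)) :
    Nonempty (DehornoyLike.StandardAction m n) ∧
    DehornoyLike.IsDehornoyLike (DehornoyLike.S m n)
      (DehornoyLike.dehornoyLT (DehornoyLike.S m n)) ∧
    ∀ (A : DehornoyLike.StandardAction m n) (O E F : ℝ),
      (O : AddCircle (1 : ℝ)) = A.ι (DehornoyLike.Code.ones hm hn false).toEnd →
      E = A.point O 0 (DehornoyLike.Code.ones hm hn false) →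
      F = A.point O 0 (DehornoyLike.Code.ones hm hn true) →
      DehornoyLike.IsLeftOrdering (DehornoyLike.ltOfPoints A.Θ ![E, F]) ∧
      ∀ g h : DehornoyLike.Gmn m n,
        DehornoyLike.ltOfPoints A.Θ ![E, F] g h ↔
          DehornoyLike.dehornoyLT (DehornoyLike.S m n) g h := by
  open DehornoyLike in
  have hm3 : 3 ≤ m := by
    by_contra! h
    obtain rfl : m = 2 := by omega
    obtain rfl : n = 2 := by omega
    exact hne rfl
  have htri := sigmaPositive_trichotomy hm hn
  have main : ∀ (A : StandardAction m n) (O E F : ℝ),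
      (O : AddCircle (1 : ℝ)) = A.ι (Code.ones hm hn false).toEnd →
      E = A.point O 0 (Code.ones hm hn false) → F = A.point O 0 (Code.ones hm hn true) →
      IsLeftOrdering (ltOfPoints A.Θ ![E, F]) ∧
      ∀ g h : Gmn m n, ltOfPoints A.Θ ![E, F] g h ↔ dehornoyLT (S m n) g h := by
    intro A O E F hO hE hF
    obtain ⟨h0, h1, h2⟩ := StandardAction.points_action hn hm3 hO hE hF
    have hpos := fun g hg =>
      ltOfPoints_one_of_mem_sigmaPositive A.Θ (g := g) h0 h1 h2 hg
    exact ⟨isLeftOrdering_ltOfPoints A.Θ _ _ htri hpos,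
      ltOfPoints_iff_dehornoyLT A.Θ _ _ htri hpos⟩
  refine ⟨⟨standardAction hm hn⟩, ⟨closure_S hm, ?_, ?_⟩, main⟩
  -- That `<_D` is a left ordering is read off from the constructed action, for any lift `O` of the
  -- end `-111…`.
  · obtain ⟨O, hO⟩ := QuotientAddGroup.mk_surjective
      ((standardAction hm hn).ι (Code.ones hm hn false).toEnd)
    obtain ⟨h1, h2⟩ := main (standardAction hm hn) O _ _ hO rfl rfl
    have e : ltOfPoints (standardAction hm hn).Θ _ = dehornoyLT (S m n) :=
      funext fun g => funext fun h => propext (h2 g h)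
    rwa [e] at h1
  · ext g
    simp [dehornoyLT]
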